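/- Let $G$ be a finite simple graph with nonempty vertex set, regular of degree $d\ge 1$, and let $N$ be its number of edges. Color the vertices independently, each vertex receiving color $i\in\{1,\dots,p\}$ with probability $\pi_i$, where $0<\pi_i<1$ for every $i$, and put $B=1/\min_i \pi_i^2(1-\pi_i)$. Let $\mathbf W=(W_1,\dots,W_p)$, where $W_i$ is the number of edges of $G$ both of whose vertices have color $i$. Then $E\mathbf W=\boldsymbol\lambda=N(\pi_1^2,\dots,\pi_p^2)$, and $\mathrm{Var}(\mathbf W)=\Sigma=(\sigma_{ij})$ is positive definite with $$\sigma_{ii}=N\pi_i^2(1-\pi_i^2)+2N(d-1)(\pi_i^3-\pi_i^4),\qquad \sigma_{ij}=-N(2d-1)\pi_i^2\pi_j^2\quad(i\ne j).$$ For every $h:\mathbb R^p\to\mathbb R$ all of whose mixed partial derivatives of orders $1,2,3$ exist everywhere and are bounded, the expectations below exist and $$\bigl|E\,h(\Sigma^{-1/2}(\mathbf W-\boldsymbol\lambda))-E\,h(\mathbf Z)\bigr|\le N^{-1/2}M\Bigl\{p^4B\,\|D^2h\|\,d^{3/2}+p^6B^{3/2}\,\|D^3h\|\,d^2\Bigr\},$$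 where $\mathbf Z$ is a standard normal vector in $\mathbb R^p$, $\|D^kh\|$ is the supremum over all points of the largest absolute value of a $k$-th order partial derivative of $h$, $\Sigma^{-1/2}$ is the positive definite square root of $\Sigma^{-1}$, and $M$ is a universal constant (depending on none of $G,d,N,p,\pi,h$). Consequently asymptotic joint normality holds: if $p$ is fixed and, for each $n$, $G_n$ is a graph as above, regular of degree $d_n\geq 1$ with $N_n$ edges, colored as above with probabilities $\pi^{(n)}$, and if $N_n^{-1/2}B_n^{3/2}d_n^2\to0$, where $B_n$ is the above constant for $\pi^{(n)}$ (for example if $d_n$ and $\pi^{(n)}$ do not depend on $n$ and $N_n\to\infty$), then $\Sigma_n^{-1/2}(\mathbf W_n-\boldsymbol\lambda_n)$ converges in distribution to the standard normal law on $\mathbb R^p$. -/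

import Mathlib

open MeasureTheory ProbabilityTheory Filter Topology Matrix

universe u v

noncomputable section

namespace ColorMatching

/-- The partial derivative `∂f/∂x_i` of a real function on `ℝ^p`. -/
def partialDeriv {p : ℕ} (i : Fin p) (f : (Fin p → ℝ) → ℝ) : (Fin p → ℝ) → ℝ :=
  fun x => lineDeriv ℝ f x (Pi.single i 1)

/-- All first partial derivatives of `f` exist at every point. -/
def HasPartials {p : ℕ} (f : (Fin p → ℝ) → ℝ) : Prop :=
  ∀ (i : Fin p) (x : Fin p → ℝ), LineDifferentiableAt ℝ f x (Pi.single i 1)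

/-- All mixed partial derivatives of `h` of orders 1, 2 and 3 exist everywhere and are bounded.
(No boundedness of `h` itself and no continuity of the third derivatives is required.) -/
structure HasBoundedPartials {p : ℕ} (h : (Fin p → ℝ) → ℝ) : Prop where
  exists_one : HasPartials h
  exists_two : ∀ i, HasPartials (partialDeriv i h)
  exists_three : ∀ i j, HasPartials (partialDeriv j (partialDeriv i h))
  bounded_one : ∃ C : ℝ, ∀ i x, |partialDeriv i h x| ≤ C
  bounded_two : ∃ C : ℝ, ∀ i j x, |partialDeriv j (partialDeriv i h) x| ≤ C
  bounded_three :
    ∃ C : ℝ, ∀ i j k x, |partialDeriv k (partialDeriv j (partialDeriv i h)) x| ≤ C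

/-- `‖D²h‖`: supremum over all points of the largest absolute value of an entry of the array of
second partial derivatives. -/
def normD2 {p : ℕ} (h : (Fin p → ℝ) → ℝ) : ℝ :=
  ⨆ q : (Fin p × Fin p) × (Fin p → ℝ), |partialDeriv q.1.2 (partialDeriv q.1.1 h) q.2|

/-- `‖D³h‖`: supremum over all points of the largest absolute value of an entry of the array of
third partial derivatives. -/
def normD3 {p : ℕ} (h : (Fin p → ℝ) → ℝ) : ℝ :=
  ⨆ q : (Fin p × Fin p × Fin p) × (Fin p → ℝ),
    |partialDeriv q.1.2.2 (partialDeriv q.1.2.1 (partialDeriv q.1.1 h)) q.2|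

/-- The standard normal law on `ℝ^p`: mean zero, covariance the identity. -/
def stdNormal (p : ℕ) : Measure (Fin p → ℝ) :=
  Measure.pi fun _ => gaussianReal 0 1

instance (p : ℕ) : IsProbabilityMeasure (stdNormal p) := by
  unfold stdNormal; infer_instance

/-- The vertices are colored independently, each receiving color `i` with probability `π i`;
`c v` is the random color of the vertex `v`. -/
structure IsIndepColoring {V Ω : Type*} [MeasurableSpace Ω] {p : ℕ} (μ : Measure Ω)
    (π : Fin p → ℝ) (c : V → Ω → Fin p) : Prop where
  measurable : ∀ v, Measurable (c v)
  indep : iIndepFun c μ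
  prob : ∀ v i, μ.real {ω | c v ω = i} = π i

section Graph

variable {V Ω : Type*} [Fintype V] [DecidableEq V] {p : ℕ}

/-- The number `N` of edges. -/
def numEdges (G : SimpleGraph V) [DecidableRel G.Adj] : ℕ := G.edgeFinset.card

open Classical in
/-- `W_i`: the number of edges of `G` both of whose end vertices have color `i`. -/
def monoCount (G : SimpleGraph V) [DecidableRel G.Adj] (c : V → Ω → Fin p) (i : Fin p) (ω : Ω) :
    ℕ :=
  (G.edgeFinset.filter fun e => ∀ v ∈ e, c v ω = i).card

/-- `λ_i = N π_i²`. -/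
def meanVec (G : SimpleGraph V) [DecidableRel G.Adj] (π : Fin p → ℝ) : Fin p → ℝ :=
  fun i => (numEdges G : ℝ) * π i ^ 2

/-- The matrix `Σ`. -/
def covMatrix (G : SimpleGraph V) [DecidableRel G.Adj] (d : ℕ) (π : Fin p → ℝ) :
    Matrix (Fin p) (Fin p) ℝ :=
  Matrix.of fun i j =>
    if i = j then
      (numEdges G : ℝ) * π i ^ 2 * (1 - π i ^ 2)
        + 2 * (numEdges G : ℝ) * ((d : ℝ) - 1) * (π i ^ 3 - π i ^ 4)
    else -((numEdges G : ℝ) * (2 * (d : ℝ) - 1) * π i ^ 2 * π j ^ 2)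

open scoped MatrixOrder in
/-- `S^{-1/2}`, the positive semidefinite square root of `S⁻¹`, for positive definite `S`. -/
def invSqrt (S : Matrix (Fin p) (Fin p) ℝ) : Matrix (Fin p) (Fin p) ℝ := CFC.sqrt S⁻¹

/-- `Σ^{-1/2} (W - λ)`. -/
def standardizedCount (G : SimpleGraph V) [DecidableRel G.Adj] (d : ℕ) (π : Fin p → ℝ)
    (c : V → Ω → Fin p) (ω : Ω) : Fin p → ℝ :=
  invSqrt (covMatrix G d π) *ᵥ fun i => (monoCount G c i ω : ℝ) - meanVec G π i

end Graph

/-- `B = 1 / min_i π_i² (1 - π_i)`. -/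
def constB {p : ℕ} (π : Fin p → ℝ) : ℝ := 1 / ⨅ i, π i ^ 2 * (1 - π i)

end ColorMatching

end

/-! The vector T = Σ^{-1/2}(W − λ) is a sum over edges e of centered bounded vectors ξ_e
(`stdTerm`). The path sin θ · T + cos θ · Z, 0 ≤ θ ≤ π/2, joins a Gaussian Z to T. After Gaussian
integration by parts, the θ-derivative of E h along it is cos θ times the defect E ∑ T_i g_i(T) −
sin θ · E ∑ g_ii(T), where g_i and g_ii are Gaussian smoothings of ∂_i h and ∂_i² h. So no Stein
equation is solved; a bound on the defect, uniform along the path, suffices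
(`HasBoundedPartials.abs_integral_sub_le`, `abs_stein_defect_le`).

The defect is small by local dependence. If b_e is the sum of ξ over the edges touching e, then ξ_e
is independent of T − b_e, so E ξ_e g_i(T − b_e) = 0. Taylor expansion about T brings in the matrix
∑ ξ_e b_eᵀ. Its mean is exactly the identity, and its entries have variance of order N d³ times the
fourth power of the size of ξ_e, because a touching pair of edges meets only O(d²) others; this
gives the D² term. The remainders, one per edge and cubic in ξ, give the D³ term.

The size of ξ_e is √(B/N) up to a constant. This comes from writing the quadratic form of Σ as a
nonnegative combination of two variances, which bounds the rows of Σ^{-1/2} (`sum_invSqrt_sq_le`).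

For the limit law, the bound is applied to cosine waves, whose expectations are the real and
imaginary parts of characteristic functions. -/

namespace ColorMatching

/-! ### Taylor estimates from bounded partial derivatives alone -/

section Calculus

variable {p : ℕ} {f h : (Fin p → ℝ) → ℝ}

lemma HasPartials.hasDerivAt (hf : HasPartials f) (i : Fin p) (x : Fin p → ℝ) (t : ℝ) :
    HasDerivAt (fun s : ℝ => f (x + s • Pi.single i 1))
      (partialDeriv i f (x + t • Pi.single i 1)) t := by
  have h1 : HasDerivAt (fun s : ℝ => f (x + t • Pi.single i 1 + s • Pi.single i 1))
      (partialDeriv i f (x + t • Pi.single i 1)) 0 :=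
    (hf i (x + t • Pi.single i 1)).hasLineDerivAt
  have h2 : HasDerivAt (fun s : ℝ => s - t) 1 t := (hasDerivAt_id t).sub_const t
  rw [← sub_self t] at h1
  have h3 := HasDerivAt.comp (h := fun s : ℝ => s - t) t h1 h2
  rw [mul_one] at h3
  refine h3.congr_of_eventuallyEq (Eventually.of_forall fun s => ?_)
  simp only [Function.comp, add_assoc, ← add_smul]
  congr 3
  ring

/-- First-order increment bound along one coordinate. -/
lemma HasPartials.abs_increment_le (hf : HasPartials f) (i : Fin p) (x : Fin p → ℝ) (c K t : ℝ)
    (hK : ∀ s : ℝ, |s| ≤ |t| → |partialDeriv i f (x + s • Pi.single i 1) - c| ≤ K) :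
    |f (x + t • Pi.single i 1) - f x - t * c| ≤ |t| * K := by
  have hd : ∀ s ∈ Set.uIcc 0 t, HasDerivWithinAt
      (fun s : ℝ => f (x + s • Pi.single i 1) - s * c)
      (partialDeriv i f (x + s • Pi.single i 1) - c) (Set.uIcc 0 t) s := fun s _ => by
    have := (hf.hasDerivAt i x s).sub ((hasDerivAt_id s).mul_const c)
    rw [one_mul] at this
    exact this.hasDerivWithinAt
  have := (convex_uIcc (0 : ℝ) t).norm_image_sub_le_of_norm_hasDerivWithin_le hd
    (C := K) (fun s hs => hK s ?_) Set.left_mem_uIcc Set.right_mem_uIcc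
  · simp only [zero_smul, add_zero, zero_mul, sub_zero, Real.norm_eq_abs] at this
    calc _ = |f (x + t • Pi.single i 1) - t * c - f x| := by congr 1; ring
      _ ≤ _ := this
      _ = _ := mul_comm _ _
  · have := Set.abs_sub_left_of_mem_uIcc hs
    simpa using this

/-- Moves from `x` to `x + y` one coordinate at a time. Every point visited is `x + z` with `|z j| ≤
|y j|`, so only partial derivatives are needed, never total differentiability. -/
lemma HasPartials.abs_sub_sub_sum_le (hf : HasPartials f) (x y c : Fin p → ℝ) (K : ℝ)
    (hK : ∀ i z, (∀ j, |z j| ≤ |y j|) → |partialDeriv i f (x + z) - c i| ≤ K) :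
    |f (x + y) - f x - ∑ i, y i * c i| ≤ (∑ i, |y i|) * K := by
  classical
  have key : ∀ s : Finset (Fin p),
      |f (x + ∑ i ∈ s, y i • Pi.single i 1) - f x - ∑ i ∈ s, y i * c i| ≤
        (∑ i ∈ s, |y i|) * K := by
    intro s
    induction s using Finset.induction_on with
    | empty => simp
    | insert a s ha ih =>
      rw [Finset.sum_insert ha, Finset.sum_insert ha, Finset.sum_insert ha, add_comm (y a • _),
        ← add_assoc]
      have h1 := hf.abs_increment_le a (x + ∑ i ∈ s, y i • Pi.single i 1) (c a) K (y a)
        (fun t ht => by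
          rw [add_assoc]
          refine hK a _ fun j => ?_
          simp only [Pi.add_apply, Finset.sum_apply, Pi.smul_apply, Pi.single_apply, smul_eq_mul,
            mul_ite, mul_one, mul_zero, Finset.sum_ite_eq]
          by_cases hj : j = a
          · subst hj; simpa [ha] using ht
          · by_cases hs : j ∈ s <;> simp [hj, hs])
      calc _ = |(f (x + ∑ i ∈ s, y i • Pi.single i 1 + y a • Pi.single a 1)
              - f (x + ∑ i ∈ s, y i • Pi.single i 1) - y a * c a)
            + (f (x + ∑ i ∈ s, y i • Pi.single i 1) - f x - ∑ i ∈ s, y i * c i)| := by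
              congr 1; ring
        _ ≤ _ := (abs_add_le _ _).trans (by rw [add_mul]; exact add_le_add h1 ih)
  have hy : ∑ i, y i • (Pi.single i 1 : Fin p → ℝ) = y := by
    ext j; simp [Finset.sum_apply, Pi.single_apply]
  simpa only [hy] using key Finset.univ

lemma HasPartials.abs_sub_le (hf : HasPartials f) {C : ℝ} (hC : ∀ i x, |partialDeriv i f x| ≤ C)
    (x y : Fin p → ℝ) : |f (x + y) - f x| ≤ (∑ i, |y i|) * C := by
  simpa using hf.abs_sub_sub_sum_le x y 0 C (fun i z _ => by simpa using hC i (x + z))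

/-- Second-order Taylor bound for functions with bounded second partial derivatives. -/
lemma HasPartials.abs_taylor_le (hf : HasPartials f) (hf' : ∀ i, HasPartials (partialDeriv i f))
    {C : ℝ} (hC : ∀ i j x, |partialDeriv j (partialDeriv i f) x| ≤ C) (x y : Fin p → ℝ) :
    |f (x + y) - f x - ∑ i, y i * partialDeriv i f x| ≤ (∑ i, |y i|) ^ 2 * C := by
  rw [sq, mul_assoc]
  -- Compare with the gradient at `x`; its oscillation over the box is controlled by the second
  -- partials.
  refine hf.abs_sub_sub_sum_le x y (fun i => partialDeriv i f x) _ fun i z hz => ?_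
  refine ((hf' i).abs_sub_le (hC i) x z).trans ?_
  exact mul_le_mul_of_nonneg_right (Finset.sum_le_sum fun j _ => hz j)
    ((abs_nonneg _).trans (hC i i x))

lemma sum_abs_le_mul_norm (y : Fin p → ℝ) : ∑ i, |y i| ≤ p * ‖y‖ := by
  calc ∑ i, |y i| ≤ ∑ _i : Fin p, ‖y‖ := Finset.sum_le_sum fun i _ => norm_le_pi_norm y i
    _ = _ := by simp

lemma HasPartials.continuous (hf : HasPartials f) {C : ℝ}
    (hC : ∀ i x, |partialDeriv i f x| ≤ C) : Continuous f := by
  -- For `p = 0` the bound is vacuous and `C` may be negative.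
  rcases Nat.eq_zero_or_pos p with rfl | hp
  · exact continuous_of_discreteTopology
  have hC0 : 0 ≤ C := (abs_nonneg _).trans (hC ⟨0, hp⟩ 0)
  refine (LipschitzWith.of_dist_le_mul (K := ⟨p * C, by positivity⟩) fun x y => ?_).continuous
  have := hf.abs_sub_le hC y (x - y)
  rw [add_sub_cancel] at this
  rw [Real.dist_eq, dist_eq_norm]
  refine this.trans ?_
  calc _ ≤ (p * ‖x - y‖) * C := mul_le_mul_of_nonneg_right (sum_abs_le_mul_norm _) hC0
    _ = p * C * ‖x - y‖ := by ring

/-- The linear form `y ↦ ∑ i, y i * c i`. -/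
noncomputable def coordForm (c : Fin p → ℝ) : (Fin p → ℝ) →L[ℝ] ℝ :=
  ∑ i, c i • ContinuousLinearMap.proj (R := ℝ) (φ := fun _ : Fin p => ℝ) i

lemma coordForm_apply (c y : Fin p → ℝ) : coordForm c y = ∑ i, y i * c i := by
  simp [coordForm, mul_comm]

lemma HasPartials.hasFDerivAt (hf : HasPartials f) (hf' : ∀ i, HasPartials (partialDeriv i f))
    {C : ℝ} (hC : ∀ i j x, |partialDeriv j (partialDeriv i f) x| ≤ C) (x : Fin p → ℝ) :
    HasFDerivAt f (coordForm fun i => partialDeriv i f x) x := by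
  rw [hasFDerivAt_iff_isLittleO_nhds_zero]
  have : (fun y : Fin p → ℝ => f (x + y) - f x -
      coordForm (fun i => partialDeriv i f x) y)
      =O[𝓝 0] fun y => ‖y‖ ^ 2 := by
    refine Asymptotics.IsBigO.of_bound (p ^ 2 * |C|) (Eventually.of_forall fun y => ?_)
    have h1 := hf.abs_taylor_le hf' hC x y
    rw [coordForm_apply, Real.norm_eq_abs, norm_pow, norm_norm]
    calc _ ≤ _ := h1
      _ ≤ (∑ i, |y i|) ^ 2 * |C| := by gcongr; exact le_abs_self C
      _ ≤ (p * ‖y‖) ^ 2 * |C| := by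
        exact mul_le_mul_of_nonneg_right (pow_le_pow_left₀
          (Finset.sum_nonneg fun i _ => abs_nonneg _) (sum_abs_le_mul_norm y) 2) (abs_nonneg _)
      _ = _ := by ring
  exact this.trans_isLittleO (by
    simpa using Asymptotics.isLittleO_norm_pow_id (E' := Fin p → ℝ) one_lt_two)

lemma HasBoundedPartials.continuous (H : HasBoundedPartials h) : Continuous h :=
  H.exists_one.continuous H.bounded_one.choose_spec

lemma HasBoundedPartials.continuous_one (H : HasBoundedPartials h) (i : Fin p) :
    Continuous (partialDeriv i h) :=
  (H.exists_two i).continuous (H.bounded_two.choose_spec i)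

lemma HasBoundedPartials.continuous_two (H : HasBoundedPartials h) (i j : Fin p) :
    Continuous (partialDeriv j (partialDeriv i h)) :=
  (H.exists_three i j).continuous (H.bounded_three.choose_spec i j)

lemma HasBoundedPartials.hasFDerivAt (H : HasBoundedPartials h) (x : Fin p → ℝ) :
    HasFDerivAt h (coordForm fun i => partialDeriv i h x) x :=
  H.exists_one.hasFDerivAt H.exists_two H.bounded_two.choose_spec x

/-- Boundedness matters here: a real supremum over an unbounded family is 0 by convention. -/
lemma HasBoundedPartials.le_normD2 (H : HasBoundedPartials h) (i j : Fin p) (x : Fin p → ℝ) :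
    |partialDeriv j (partialDeriv i h) x| ≤ normD2 h :=
  le_ciSup (f := fun q : (Fin p × Fin p) × (Fin p → ℝ) =>
    |partialDeriv q.1.2 (partialDeriv q.1.1 h) q.2|)
    ⟨H.bounded_two.choose, by rintro _ ⟨q, rfl⟩; exact H.bounded_two.choose_spec _ _ _⟩ ((i, j), x)

lemma HasBoundedPartials.le_normD3 (H : HasBoundedPartials h) (i j k : Fin p) (x : Fin p → ℝ) :
    |partialDeriv k (partialDeriv j (partialDeriv i h)) x| ≤ normD3 h :=
  le_ciSup (f := fun q : (Fin p × Fin p × Fin p) × (Fin p → ℝ) =>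
    |partialDeriv q.1.2.2 (partialDeriv q.1.2.1 (partialDeriv q.1.1 h)) q.2|)
    ⟨H.bounded_three.choose, by rintro _ ⟨q, rfl⟩; exact H.bounded_three.choose_spec _ _ _ _⟩
    ((i, j, k), x)

lemma normD2_nonneg : 0 ≤ normD2 h := Real.iSup_nonneg fun _ => abs_nonneg _

lemma normD3_nonneg : 0 ≤ normD3 h := Real.iSup_nonneg fun _ => abs_nonneg _

end Calculus

/-! ### Gaussian integration by parts -/

section Gaussian

lemma integrable_gaussianReal_iff {f : ℝ → ℝ} :
    Integrable f (gaussianReal 0 1) ↔ Integrable fun x => gaussianPDFReal 0 1 x * f x := by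
  rw [gaussianReal_of_var_ne_zero _ one_ne_zero, integrable_withDensity_iff_integrable_smul'
    (measurable_gaussianPDF 0 1) (Eventually.of_forall fun _ => gaussianPDF_lt_top)]
  simp [toReal_gaussianPDF]

lemma hasDerivAt_gaussianPDFReal (x : ℝ) :
    HasDerivAt (gaussianPDFReal 0 1) (-(x * gaussianPDFReal 0 1 x)) x := by
  have h : HasDerivAt (fun y : ℝ => -y ^ 2 / 2) (-x) x := by
    exact (((hasDerivAt_pow 2 x).neg).div_const 2).congr_deriv (by ring)
  have h2 := (h.exp).const_mul ((√(2 * Real.pi))⁻¹)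
  have e : gaussianPDFReal 0 1 = fun y => (√(2 * Real.pi))⁻¹ * Real.exp (-y ^ 2 / 2) := by
    ext y; simp [gaussianPDFReal]
  rw [e]
  exact h2.congr_deriv (by ring)

/-- Gaussian integration by parts on the line. -/
lemma integral_id_mul_gaussianReal {φ φ' : ℝ → ℝ} (hd : ∀ t, HasDerivAt φ (φ' t) t)
    (hφ : Integrable φ (gaussianReal 0 1)) (hφ' : Integrable φ' (gaussianReal 0 1))
    (hm : Integrable (fun t => t * φ t) (gaussianReal 0 1)) :
    ∫ t, t * φ t ∂gaussianReal 0 1 = ∫ t, φ' t ∂gaussianReal 0 1 := by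
  rw [integrable_gaussianReal_iff] at hφ hφ' hm
  rw [integral_gaussianReal_eq_integral_smul one_ne_zero,
    integral_gaussianReal_eq_integral_smul one_ne_zero]
  have := integral_mul_deriv_eq_deriv_mul_of_integrable (u := gaussianPDFReal 0 1) (v := φ)
    (u' := fun x => -(x * gaussianPDFReal 0 1 x)) (v' := φ')
    (fun x _ => hasDerivAt_gaussianPDFReal x) (fun x _ => hd x) hφ' (by
      refine hm.neg.congr (Eventually.of_forall fun x => ?_)
      simp only [Pi.neg_apply, Pi.mul_apply]
      ring) hφ
  simp only [smul_eq_mul]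
  rw [this, ← integral_neg]
  congr 1
  ext x
  ring

/-- Gaussian integration by parts on `ℝ^p`. -/
lemma integral_coord_mul_stdNormal {p : ℕ} (i : Fin p) {φ φ' : (Fin p → ℝ) → ℝ}
    (hd : ∀ z t, HasDerivAt (fun s => φ (Function.update z i s)) (φ' (Function.update z i t)) t)
    (hφ : Integrable φ (stdNormal p)) (hφ' : Integrable φ' (stdNormal p))
    (hm : Integrable (fun z => z i * φ z) (stdNormal p)) :
    ∫ z, z i * φ z ∂stdNormal p = ∫ z, φ' z ∂stdNormal p := by
  obtain _ | n := p
  · exact i.elim0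
  -- Split off coordinate `i`; by Fubini the identity reduces to the one-dimensional one on almost
  -- every line in that direction.
  have hmp := (measurePreserving_piFinSuccAbove
    (fun _ : Fin (n + 1) => gaussianReal 0 1) i).symm
  have tr : ∀ f : (Fin (n + 1) → ℝ) → ℝ, Integrable f (stdNormal (n + 1)) →
      Integrable (fun q : ℝ × (Fin n → ℝ) => f (i.insertNth q.1 q.2))
        ((gaussianReal 0 1).prod (Measure.pi fun _ => gaussianReal 0 1)) := fun f hf =>
    (hmp.integrable_comp_emb (MeasurableEquiv.measurableEmbedding _)).2 hf
  have ti : ∀ f : (Fin (n + 1) → ℝ) → ℝ, Integrable f (stdNormal (n + 1)) →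
      ∫ z, f z ∂stdNormal (n + 1) =
        ∫ y : Fin n → ℝ, ∫ t : ℝ, f (i.insertNth t y) ∂gaussianReal 0 1
          ∂Measure.pi fun _ => gaussianReal 0 1 := fun f hf => by
    rw [← integral_prod_symm _ (tr f hf)]
    exact (hmp.integral_comp (MeasurableEquiv.measurableEmbedding _) f).symm
  rw [ti _ hm, ti _ hφ']
  refine integral_congr_ae ?_
  filter_upwards [(tr _ hφ).prod_left_ae, (tr _ hφ').prod_left_ae, (tr _ hm).prod_left_ae]
    with y h1 h2 h3
  simp only [Fin.insertNth_apply_same] at h3 ⊢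
  refine integral_id_mul_gaussianReal (fun t => ?_) h1 h2 h3
  simpa only [Fin.update_insertNth] using hd (i.insertNth 0 y) t

lemma integrable_coord_stdNormal {p : ℕ} (i : Fin p) :
    Integrable (fun z : Fin p → ℝ => z i) (stdNormal p) := by
  have h : Integrable (fun x : ℝ => x) (gaussianReal 0 1) :=
    memLp_one_iff_integrable.1 (memLp_id_gaussianReal (μ := 0) (v := 1) 1)
  exact integrable_comp_eval (μ := fun _ : Fin p => gaussianReal 0 1) (i := i) h

end Gaussian

/-! ### Gaussian smoothing and the derivative of the interpolation -/

section Smoothing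

variable {p : ℕ} {f h : (Fin p → ℝ) → ℝ}

/-- `x ↦ E f(s x + c Z)` with `Z` standard normal. -/
noncomputable def gaussSmooth (f : (Fin p → ℝ) → ℝ) (s c : ℝ) (x : Fin p → ℝ) : ℝ :=
  ∫ z, f (s • x + c • z) ∂stdNormal p

/-- Bounded partials force at most linear growth, and the Gaussian has first moments; the function
itself may be unbounded. -/
lemma integrable_of_partials_bounded (hf : HasPartials f) {C : ℝ}
    (hC : ∀ i x, |partialDeriv i f x| ≤ C) (s c : ℝ) (x : Fin p → ℝ) :
    Integrable (fun z => f (s • x + c • z)) (stdNormal p) := by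
  have hb : Integrable (fun z : Fin p → ℝ => |f (s • x)| + (∑ i, |c| * |z i|) * C)
      (stdNormal p) :=
    (integrable_const _).add ((integrable_finsetSum _ fun i _ =>
      ((integrable_coord_stdNormal i).abs.const_mul _)).mul_const _)
  have hcont := hf.continuous hC
  refine hb.mono' (by fun_prop) (Eventually.of_forall fun z => ?_)
  have h1 := hf.abs_sub_le hC (s • x) (c • z)
  simp only [Pi.smul_apply, smul_eq_mul, abs_mul] at h1
  have h2 := abs_sub_abs_le_abs_sub (f (s • x + c • z)) (f (s • x))
  rw [Real.norm_eq_abs]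
  linarith

lemma integrable_of_bounded {C : ℝ} (hf : Continuous f) (hC : ∀ x, |f x| ≤ C) (s c : ℝ)
    (x : Fin p → ℝ) : Integrable (fun z => f (s • x + c • z)) (stdNormal p) :=
  Integrable.of_bound (by fun_prop) C (Eventually.of_forall fun _ => hC _)

lemma abs_gaussSmooth_le {C : ℝ} (hC : ∀ x, |f x| ≤ C) (s c : ℝ) (x : Fin p → ℝ) :
    |gaussSmooth f s c x| ≤ C := by
  have := norm_integral_le_of_norm_le_const (μ := stdNormal p)
    (f := fun z => f (s • x + c • z)) (C := C) (Eventually.of_forall fun _ => hC _)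
  simpa [gaussSmooth] using this

lemma HasBoundedPartials.hasDerivAt_update (H : HasBoundedPartials h) (s c : ℝ)
    (x : Fin p → ℝ) (i : Fin p) (z : Fin p → ℝ) (t : ℝ) :
    HasDerivAt (fun u => partialDeriv i h (s • x + c • Function.update z i u))
      (c * partialDeriv i (partialDeriv i h) (s • x + c • Function.update z i t)) t := by
  have e : ∀ u : ℝ, s • x + c • Function.update z i u =
      (s • x + c • Function.update z i 0) + (c * u) • Pi.single i 1 := fun u => by
    ext j
    by_cases hj : j = i
    · subst hj; simp
    · simp [hj]
  rw [funext fun u => congrArg (partialDeriv i h) (e u), e t]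
  have h1 := (H.exists_two i).hasDerivAt i (s • x + c • Function.update z i 0) (c * t)
  have h2 : HasDerivAt (fun u : ℝ => c * u) c t := by
    simpa using (hasDerivAt_id t).const_mul c
  have := HasDerivAt.comp (h := fun u : ℝ => c * u) t h1 h2
  rwa [mul_comm] at this

/-- Differentiating in `z i` costs a factor `c`. This turns the Gaussian part of the θ-derivative
into a sum of pure second partials. -/
lemma HasBoundedPartials.integral_coord_mul (H : HasBoundedPartials h) (s c : ℝ)
    (x : Fin p → ℝ) (i : Fin p) :
    Integrable (fun z => z i * partialDeriv i h (s • x + c • z)) (stdNormal p) ∧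
    ∫ z, z i * partialDeriv i h (s • x + c • z) ∂stdNormal p =
      c * gaussSmooth (partialDeriv i (partialDeriv i h)) s c x := by
  obtain ⟨C, hC⟩ := H.bounded_one
  have hc := H.continuous_one i
  have hm : Integrable (fun z => z i * partialDeriv i h (s • x + c • z)) (stdNormal p) :=
    (integrable_coord_stdNormal i).mul_bdd (c := C) (by fun_prop)
      (Eventually.of_forall fun _ => hC _ _)
  refine ⟨hm, ?_⟩
  rw [gaussSmooth, ← integral_const_mul]
  exact integral_coord_mul_stdNormal i (H.hasDerivAt_update s c x i)
    (integrable_of_bounded hc (hC i) s c x)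
    ((integrable_of_bounded (H.continuous_two i i) (H.le_normD2 i i) s c x).const_mul c) hm

/-- The derivative of the interpolation between `h` and its Gaussian mean. -/
lemma HasBoundedPartials.hasDerivAt_gaussSmooth (H : HasBoundedPartials h) (x : Fin p → ℝ)
    (θ : ℝ) :
    HasDerivAt (fun θ => gaussSmooth h (Real.sin θ) (Real.cos θ) x)
      (Real.cos θ * (∑ i, x i * gaussSmooth (partialDeriv i h) (Real.sin θ) (Real.cos θ) x)
        - Real.sin θ * Real.cos θ *
          ∑ i, gaussSmooth (partialDeriv i (partialDeriv i h)) (Real.sin θ) (Real.cos θ) x) θ := by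
  obtain ⟨C, hC⟩ := H.bounded_one
  have hcont := H.continuous
  have hcont1 := H.continuous_one
  -- Chain rule: the velocity of the path is cos θ · x − sin θ · z.
  set F' : ℝ → (Fin p → ℝ) → ℝ := fun θ z => ∑ i, (Real.cos θ * x i - Real.sin θ * z i) *
    partialDeriv i h (Real.sin θ • x + Real.cos θ • z) with hF'
  have hder : ∀ z θ, HasDerivAt (fun θ => h (Real.sin θ • x + Real.cos θ • z)) (F' θ z) θ := by
    intro z θ
    have hp : HasDerivAt (fun θ => Real.sin θ • x + Real.cos θ • z)
        (Real.cos θ • x + (-Real.sin θ) • z) θ :=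
      ((Real.hasDerivAt_sin θ).smul_const x).add ((Real.hasDerivAt_cos θ).smul_const z)
    have := (H.hasFDerivAt (Real.sin θ • x + Real.cos θ • z)).comp_hasDerivAt θ hp
    rw [coordForm_apply] at this
    refine this.congr_deriv ?_
    simp only [hF']
    refine Finset.sum_congr rfl fun i _ => ?_
    simp only [Pi.add_apply, Pi.smul_apply, smul_eq_mul]
    ring
  have hbi : Integrable (fun z : Fin p → ℝ => ∑ i, (|x i| + |z i|) * C) (stdNormal p) :=
    integrable_finsetSum _ fun i _ =>
      ((integrable_const _).add (integrable_coord_stdNormal i).abs).mul_const _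
  -- Since |sin| and |cos| are at most 1, the dominating function does not depend on θ.
  have main := (hasDerivAt_integral_of_dominated_loc_of_deriv_le (μ := stdNormal p)
    (F := fun θ z => h (Real.sin θ • x + Real.cos θ • z)) (F' := F') (x₀ := θ)
    (bound := fun z => ∑ i, (|x i| + |z i|) * C) (s := Set.univ) univ_mem
    (Eventually.of_forall fun θ => by fun_prop)
    (integrable_of_partials_bounded H.exists_one hC _ _ x) (by fun_prop)
    (Eventually.of_forall fun z θ _ => ?_) hbi (Eventually.of_forall fun z θ _ => hder z θ)).2
  · refine main.congr_deriv (Eq.symm ?_)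
    have hI : ∀ i, Integrable (fun z => partialDeriv i h (Real.sin θ • x + Real.cos θ • z))
        (stdNormal p) := fun i => integrable_of_bounded (hcont1 i) (hC i) _ _ _
    have hJ := fun i => H.integral_coord_mul (Real.sin θ) (Real.cos θ) x i
    have e : ∀ i, ∫ z, (Real.cos θ * x i - Real.sin θ * z i) *
        partialDeriv i h (Real.sin θ • x + Real.cos θ • z) ∂stdNormal p =
        Real.cos θ * x i * gaussSmooth (partialDeriv i h) (Real.sin θ) (Real.cos θ) x -
        Real.sin θ * (Real.cos θ *
          gaussSmooth (partialDeriv i (partialDeriv i h)) (Real.sin θ) (Real.cos θ) x) := by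
      intro i
      rw [← (hJ i).2, gaussSmooth, ← integral_const_mul, ← integral_const_mul, ← integral_sub
        ((hI i).const_mul _) ((hJ i).1.const_mul _)]
      congr 1
      ext z
      ring
    simp only [hF']
    rw [integral_finsetSum]
    · simp only [e, Finset.sum_sub_distrib, Finset.mul_sum]
      congr 1 <;> exact Finset.sum_congr rfl fun i _ => by ring
    · intro i _
      refine (((hI i).const_mul (Real.cos θ * x i)).sub
        ((hJ i).1.const_mul (Real.sin θ))).congr (Eventually.of_forall fun z => ?_)
      simp only [Pi.sub_apply]
      ring
  · simp only [hF', Real.norm_eq_abs]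
    refine (Finset.abs_sum_le_sum_abs _ _).trans (Finset.sum_le_sum fun i _ => ?_)
    rw [abs_mul]
    refine mul_le_mul ?_ (hC _ _) (abs_nonneg _) (by positivity)
    refine (abs_sub _ _).trans (add_le_add ?_ ?_) <;> rw [abs_mul]
    · exact mul_le_of_le_one_left (abs_nonneg _) (Real.abs_cos_le_one θ)
    · exact mul_le_of_le_one_left (abs_nonneg _) (Real.abs_sin_le_one θ)

/-- Taylor bound for the smoothed first partial derivatives. -/
lemma HasBoundedPartials.abs_gaussSmooth_taylor_le (H : HasBoundedPartials h) (i : Fin p)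
    (s c : ℝ) (x y : Fin p → ℝ) :
    |gaussSmooth (partialDeriv i h) s c (x + y) - gaussSmooth (partialDeriv i h) s c x
      - s * ∑ j, y j * gaussSmooth (partialDeriv j (partialDeriv i h)) s c x| ≤
      s ^ 2 * (∑ j, |y j|) ^ 2 * normD3 h := by
  obtain ⟨C, hC⟩ := H.bounded_one
  have h1 := fun x => integrable_of_bounded (H.continuous_one i) (hC i) s c x
  have h2 := fun j => integrable_of_bounded (H.continuous_two i j) (H.le_normD2 i j) s c x
  have hb : ∀ z, ‖partialDeriv i h (s • (x + y) + c • z) - partialDeriv i h (s • x + c • z)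
      - s * ∑ j, y j * partialDeriv j (partialDeriv i h) (s • x + c • z)‖ ≤
      s ^ 2 * (∑ j, |y j|) ^ 2 * normD3 h := by
    intro z
    -- The expansion is made under the integral with increment `s • y`. All derivatives stay on `h`,
    -- so no negative power of `c` appears and the bound is uniform along the path.
    have := (H.exists_two i).abs_taylor_le (H.exists_three i) (H.le_normD3 i)
      (s • x + c • z) (s • y)
    simp only [Pi.smul_apply, smul_eq_mul, abs_mul, ← Finset.mul_sum, mul_pow, sq_abs,
      mul_assoc s] at this
    rw [Real.norm_eq_abs, smul_add, add_right_comm]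
    exact this
  have := norm_integral_le_of_norm_le_const (μ := stdNormal p) (Eventually.of_forall hb)
  have h3 : Integrable (fun z => ∑ j, y j * partialDeriv j (partialDeriv i h) (s • x + c • z))
      (stdNormal p) := integrable_finsetSum _ fun j _ => (h2 j).const_mul _
  have e1 := integral_sub ((h1 (x + y)).sub (h1 x)) (h3.const_mul s)
  have e2 := integral_sub (h1 (x + y)) (h1 x)
  have e3 := integral_finsetSum Finset.univ fun j _ => (h2 j).const_mul (y j)
  simp only [Pi.sub_apply, integral_const_mul] at e1 e2 e3
  rw [e1, e2, e3] at this
  simpa [gaussSmooth] using this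

end Smoothing

/-! ### The quadratic form of Σ and the size of Σ^{-1/2} -/

section LinearAlgebra

variable {p : ℕ}

lemma constB_spec [Nonempty (Fin p)] {π : Fin p → ℝ} (hπ : ∀ i, 0 < π i ∧ π i < 1) :
    1 ≤ constB π ∧ ∀ i, 1 ≤ constB π * (π i ^ 2 * (1 - π i)) := by
  obtain ⟨k, hk⟩ := exists_eq_ciInf_of_finite (f := fun i => π i ^ 2 * (1 - π i))
  have hpos : 0 < ⨅ i, π i ^ 2 * (1 - π i) := by
    rw [← hk]
    exact mul_pos (pow_pos (hπ k).1 2) (sub_pos.2 (hπ k).2)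
  have hle : ∀ i, ⨅ i, π i ^ 2 * (1 - π i) ≤ π i ^ 2 * (1 - π i) := fun i =>
    ciInf_le (Set.finite_range _).bddBelow i
  unfold constB
  refine ⟨?_, fun i => ?_⟩
  · rw [le_div_iff₀ hpos, one_mul]
    refine (hle k).trans (mul_le_one₀ (pow_le_one₀ (hπ k).1.le (hπ k).2.le) ?_ ?_) <;>
      linarith [(hπ k).1, (hπ k).2]
  · rw [one_div_mul_eq_div, le_div_iff₀ hpos, one_mul]
    exact hle i

/-- A subprobability vector `q` has variance form bounded below coordinatewise. -/
lemma sq_le_mul_variance_form {q u : Fin p → ℝ} {B : ℝ} (hB : 0 ≤ B) (hq : ∀ i, 0 ≤ q i)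
    (hq0 : 1 ≤ B * (1 - ∑ i, q i)) {i : Fin p} (hqB : 1 ≤ B * q i) :
    u i ^ 2 ≤ 2 * B * (∑ j, q j * u j ^ 2 - (∑ j, q j * u j) ^ 2) := by
  set m := ∑ j, q j * u j with hm
  -- The form is the variance of a variable with value `u j` with probability `q j` and 0 with the
  -- missing mass; the last term comes from that extra atom.
  have h1 : ∑ j, q j * u j ^ 2 - m ^ 2 = ∑ j, q j * (u j - m) ^ 2 + (1 - ∑ j, q j) * m ^ 2 := by
    have : ∑ j, q j * (u j - m) ^ 2 = ∑ j, q j * u j ^ 2 - 2 * m * m + (∑ j, q j) * m ^ 2 := by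
      conv_rhs => rw [hm, Finset.mul_sum, Finset.sum_mul, ← hm, ← Finset.sum_sub_distrib,
        ← Finset.sum_add_distrib]
      exact Finset.sum_congr rfl fun j _ => by ring
    rw [this]; ring
  have h2 : q i * (u i - m) ^ 2 ≤ ∑ j, q j * (u j - m) ^ 2 :=
    Finset.single_le_sum (f := fun j => q j * (u j - m) ^ 2)
      (fun j _ => mul_nonneg (hq j) (sq_nonneg _)) (Finset.mem_univ i)
  rw [h1]
  calc u i ^ 2 ≤ 2 * (u i - m) ^ 2 + 2 * m ^ 2 := by nlinarith [sq_nonneg (u i - m - m)]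
    _ ≤ 2 * (B * q i * (u i - m) ^ 2) + 2 * (B * (1 - ∑ j, q j) * m ^ 2) := by
      gcongr
      · exact le_mul_of_one_le_left (sq_nonneg _) hqB
      · exact le_mul_of_one_le_left (sq_nonneg _) hq0
    _ = 2 * B * (q i * (u i - m) ^ 2 + (1 - ∑ j, q j) * m ^ 2) := by ring
    _ ≤ _ := by gcongr

variable {V : Type*} [Fintype V] (G : SimpleGraph V) [DecidableRel G.Adj] (d : ℕ)

/-- Puts both cases in the form in which the moments are later computed: `numEdges G` times a
contribution that is the same for every edge. -/
lemma covMatrix_apply (π : Fin p → ℝ) (i j : Fin p) :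
    covMatrix G d π i j = numEdges G * ((if i = j then π i ^ 2 + 2 * ((d : ℝ) - 1) * π i ^ 3 else 0)
      - (2 * (d : ℝ) - 1) * (π i ^ 2 * π j ^ 2)) := by
  simp only [covMatrix, Matrix.of_apply]
  split_ifs with h
  · subst h; ring
  · ring

lemma covMatrix_isHermitian (π : Fin p → ℝ) : (covMatrix G d π).IsHermitian := by
  ext i j
  simp only [Matrix.conjTranspose_apply, star_trivial, covMatrix_apply]
  by_cases h : i = j
  · subst h; rfl
  · simp [h, Ne.symm h, mul_comm]

/-- The first bracket is a variance form for the masses π_i², the second the variance of π_i u_i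
under the law π. The second can be discarded for a lower bound when `d ≥ 1`. -/
lemma dotProduct_covMatrix_mulVec (π u : Fin p → ℝ) :
    u ⬝ᵥ covMatrix G d π *ᵥ u = numEdges G *
      ((∑ i, π i ^ 2 * u i ^ 2 - (∑ i, π i ^ 2 * u i) ^ 2) +
        2 * ((d : ℝ) - 1) * (∑ i, π i * (π i * u i) ^ 2 - (∑ i, π i * (π i * u i)) ^ 2)) := by
  have h1 : ∀ i, (covMatrix G d π *ᵥ u) i = numEdges G *
      ((π i ^ 2 + 2 * ((d : ℝ) - 1) * π i ^ 3) * u i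
        - (2 * (d : ℝ) - 1) * π i ^ 2 * ∑ j, π j ^ 2 * u j) := fun i => by
    simp only [Matrix.mulVec, dotProduct, covMatrix_apply, mul_assoc, sub_mul, ite_mul, zero_mul,
      ← Finset.mul_sum, Finset.sum_sub_distrib, Finset.sum_ite_eq, Finset.mem_univ, if_true]
  have h2 : ∑ i, π i * (π i * u i) = ∑ i, π i ^ 2 * u i :=
    Finset.sum_congr rfl fun i _ => by ring
  simp only [dotProduct, h1, h2]
  set m := ∑ j, π j ^ 2 * u j with hm
  have h3 : ∑ i, u i * (numEdges G * ((π i ^ 2 + 2 * ((d : ℝ) - 1) * π i ^ 3) * u i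
        - (2 * (d : ℝ) - 1) * π i ^ 2 * m)) = numEdges G * (∑ i, π i ^ 2 * u i ^ 2
          + 2 * ((d : ℝ) - 1) * ∑ i, π i * (π i * u i) ^ 2 - (2 * (d : ℝ) - 1) * m * m) := by
    conv_rhs => rw [hm, Finset.mul_sum, Finset.mul_sum Finset.univ _ (_ * _), ← hm,
      ← Finset.sum_add_distrib, ← Finset.sum_sub_distrib, Finset.mul_sum]
    exact Finset.sum_congr rfl fun i _ => by ring
  rw [h3]
  ring

variable {G d} {π : Fin p → ℝ}

/-- Only the variance form of the masses π_i² is kept. Both the mass π_i² and the missing mass 1 − ∑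
π_j² are at least π_i²(1 − π_i), hence at least 1/B. -/
lemma sq_le_mul_dotProduct_covMatrix_mulVec (hN : 0 < numEdges G) (hd : 1 ≤ d)
    (hπ : ∀ i, 0 < π i ∧ π i < 1) (hsum : ∑ i, π i = 1) (u : Fin p → ℝ) (i : Fin p) :
    u i ^ 2 ≤ 2 * constB π / numEdges G * (u ⬝ᵥ covMatrix G d π *ᵥ u) := by
  have : Nonempty (Fin p) := ⟨i⟩
  obtain ⟨hB1, hB⟩ := constB_spec hπ
  have hB0 : 0 ≤ constB π := by linarith
  have hN' : (0 : ℝ) < numEdges G := by exact_mod_cast hN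
  have hsq : ∀ j, 0 < π j ^ 2 := fun j => pow_pos (hπ j).1 2
  have hd' : (0 : ℝ) ≤ 2 * ((d : ℝ) - 1) := by
    have : (1 : ℝ) ≤ d := by exact_mod_cast hd
    linarith
  have hq0 : π i ^ 2 * (1 - π i) ≤ 1 - ∑ j, π j ^ 2 := by
    have : 1 - ∑ j, π j ^ 2 = ∑ j, π j * (1 - π j) := by
      rw [← hsum, ← Finset.sum_sub_distrib]
      exact Finset.sum_congr rfl fun j _ => by rw [hsum]; ring
    rw [this]
    have h1 := Finset.single_le_sum (f := fun j => π j * (1 - π j))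
      (fun j _ => mul_nonneg (hπ j).1.le (sub_nonneg.2 (hπ j).2.le)) (Finset.mem_univ i)
    have h2 : π i ^ 2 ≤ π i := by nlinarith [(hπ i).1, (hπ i).2]
    exact (mul_le_mul_of_nonneg_right h2 (sub_nonneg.2 (hπ i).2.le)).trans h1
  have hqi : π i ^ 2 * (1 - π i) ≤ π i ^ 2 :=
    mul_le_of_le_one_right (hsq i).le (by linarith [(hπ i).1])
  have h1 := sq_le_mul_variance_form (u := u) hB0 (fun j => (hsq j).le)
    ((hB i).trans (mul_le_mul_of_nonneg_left hq0 hB0))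
    ((hB i).trans (mul_le_mul_of_nonneg_left hqi hB0))
  -- Cauchy–Schwarz with weights √π_i, where ∑ π_i = 1: the second variance is nonnegative.
  have h2 : (∑ i, π i * (π i * u i)) ^ 2 ≤ ∑ i, π i * (π i * u i) ^ 2 := by
    have := Finset.sum_mul_sq_le_sq_mul_sq Finset.univ (fun i => √(π i))
      (fun i => √(π i) * (π i * u i))
    simp only [mul_pow, Real.sq_sqrt (hπ _).1.le, ← mul_assoc, Real.mul_self_sqrt (hπ _).1.le,
      hsum, one_mul] at this
    simpa only [mul_pow, ← mul_assoc] using this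
  rw [dotProduct_covMatrix_mulVec, div_mul_eq_mul_div, le_div_iff₀ hN']
  calc u i ^ 2 * numEdges G ≤ _ := mul_le_mul_of_nonneg_right h1 hN'.le
    _ = 2 * constB π * (numEdges G *
      (∑ i, π i ^ 2 * u i ^ 2 - (∑ i, π i ^ 2 * u i) ^ 2)) := by ring
    _ ≤ _ := by
      gcongr
      exact le_add_of_nonneg_right (mul_nonneg hd' (sub_nonneg.2 h2))

lemma covMatrix_posDef (hN : 0 < numEdges G) (hd : 1 ≤ d)
    (hπ : ∀ i, 0 < π i ∧ π i < 1) (hsum : ∑ i, π i = 1) : (covMatrix G d π).PosDef := by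
  refine Matrix.PosDef.of_dotProduct_mulVec_pos (covMatrix_isHermitian G d π) fun {u} hu => ?_
  obtain ⟨i, hi⟩ := Function.ne_iff.1 hu
  have : Nonempty (Fin p) := ⟨i⟩
  have h := sq_le_mul_dotProduct_covMatrix_mulVec hN hd hπ hsum u i
  have hpos : 0 < u i ^ 2 := by
    have : u i ≠ 0 := hi
    positivity
  have hc : 0 ≤ 2 * constB π / numEdges G := by
    have := (constB_spec hπ).1
    positivity
  rw [star_trivial]
  exact pos_of_mul_pos_right (hpos.trans_le h) hc

open scoped MatrixOrder in
lemma invSqrt_mul_self {S : Matrix (Fin p) (Fin p) ℝ} (hS : S.PosDef) :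
    invSqrt S * invSqrt S = S⁻¹ :=
  CFC.sqrt_mul_sqrt_self _ hS.inv.posSemidef.nonneg

open scoped MatrixOrder in
lemma invSqrt_symm (S : Matrix (Fin p) (Fin p) ℝ) (i j : Fin p) :
    invSqrt S i j = invSqrt S j i := by
  have : (invSqrt S).IsHermitian := (Matrix.nonneg_iff_posSemidef.1 (CFC.sqrt_nonneg S⁻¹)).1
  simpa using (this.apply i j).symm

lemma invSqrt_mul_mul_invSqrt {S : Matrix (Fin p) (Fin p) ℝ} (hS : S.PosDef) :
    invSqrt S * S * invSqrt S = 1 := by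
  have hu : IsUnit S.det := (Matrix.isUnit_iff_isUnit_det S).1 hS.isUnit
  rw [mul_eq_one_comm, ← mul_assoc, invSqrt_mul_self hS, Matrix.nonsing_inv_mul S hu]

/-- The squared norm of row i of Σ^{-1/2} is a = (Σ^{-1})_ii. For x = Σ^{-1} e_i both x_i and xᵀΣx
equal a, so the coordinate bound reads a² ≤ (2B/N) a, and a > 0 cancels. -/
lemma sum_invSqrt_sq_le (hN : 0 < numEdges G) (hd : 1 ≤ d)
    (hπ : ∀ i, 0 < π i ∧ π i < 1) (hsum : ∑ i, π i = 1) (i : Fin p) :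
    ∑ k, invSqrt (covMatrix G d π) i k ^ 2 ≤ 2 * constB π / numEdges G := by
  set S := covMatrix G d π with hSdef
  have hS : S.PosDef := covMatrix_posDef hN hd hπ hsum
  have hu : IsUnit S.det := (Matrix.isUnit_iff_isUnit_det S).1 hS.isUnit
  have h1 : ∑ k, invSqrt S i k ^ 2 = S⁻¹ i i := by
    rw [← invSqrt_mul_self hS, Matrix.mul_apply]
    exact Finset.sum_congr rfl fun k _ => by rw [sq, invSqrt_symm S k i]
  set x := S⁻¹ *ᵥ Pi.single i 1 with hx
  have hxi : x i = S⁻¹ i i := by simp [hx]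
  have h2 : x ⬝ᵥ S *ᵥ x = S⁻¹ i i := by
    rw [hx, Matrix.mulVec_mulVec, Matrix.mul_nonsing_inv S hu, Matrix.one_mulVec]
    simp
  have h3 := sq_le_mul_dotProduct_covMatrix_mulVec hN hd hπ hsum x i
  rw [← hSdef, h2, hxi, sq] at h3
  have hpos : 0 < S⁻¹ i i := hS.inv.diag_pos
  rw [h1]
  exact le_of_mul_le_mul_right h3 hpos

end LinearAlgebra

/-! ### Independent colorings: factorization and variance bounds -/

section Independence

variable {V : Type*} [Fintype V] {p : ℕ} {π : Fin p → ℝ}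

/-- The law of an independent coloring is that of the coordinate process on `V → Fin p`. -/
lemma IsIndepColoring.map {Ω : Type*} [MeasurableSpace Ω] {μ : Measure Ω} [IsProbabilityMeasure μ]
    {c : V → Ω → Fin p} (hc : IsIndepColoring μ π c) :
    IsIndepColoring (μ.map fun ω v => c v ω) π (fun v (k : V → Fin p) => k v) := by
  have hm : Measurable fun ω v => c v ω := measurable_pi_lambda _ hc.measurable
  have := Measure.isProbabilityMeasure_map (μ := μ) hm.aemeasurable
  refine ⟨fun v => measurable_pi_apply v, ?_, fun v i => ?_⟩
  · rw [iIndepFun_iff_map_fun_eq_pi_map fun v => (measurable_pi_apply v).aemeasurable]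
    have h := (iIndepFun_iff_map_fun_eq_pi_map fun v => (hc.measurable v).aemeasurable).1 hc.indep
    have h2 : ∀ v, (μ.map fun ω v => c v ω).map (fun k : V → Fin p => k v) = μ.map (c v) :=
      fun v => Measure.map_map (measurable_pi_apply v) hm
    simp only [h2]
    rw [← h]
    exact Measure.map_id
  · rw [map_measureReal_apply hm (Set.toFinite _).measurableSet]
    exact hc.prob v i

variable {P : Measure (V → Fin p)} [IsProbabilityMeasure P]

/-- Each factor is a function of the restriction of the coloring to its own vertex set, and
restrictions to disjoint sets are independent. -/
lemma IsIndepColoring.integral_mul_of_dependsOn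
    (hc : IsIndepColoring P π fun v (k : V → Fin p) => k v) {X Y : (V → Fin p) → ℝ}
    {S T : Finset V} (hX : DependsOn X S) (hY : DependsOn Y T) (hST : Disjoint S T) :
    ∫ k, X k * Y k ∂P = (∫ k, X k ∂P) * ∫ k, Y k ∂P := by
  classical
  obtain ⟨k₀⟩ : Nonempty (V → Fin p) := P.nonempty_of_neZero
  -- A fixed coloring `k₀` supplies irrelevant values off `S`, so that a partial coloring can be fed
  -- to the function.
  let ext (S : Finset V) (r : S → Fin p) : V → Fin p :=
    fun v => if h : v ∈ S then r ⟨v, h⟩ else k₀ v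
  have fac : ∀ {Z : (V → Fin p) → ℝ} {S : Finset V}, DependsOn Z S →
      Z = (fun r => Z (ext S r)) ∘ fun k (v : S) => k v := fun {Z S} hZ => by
    funext k
    refine hZ fun v hv => ?_
    have hv' : v ∈ S := hv
    simp [ext, hv']
  have ind := hc.indep.indepFun_finset S T hST hc.measurable
  have hXY : IndepFun X Y P := by
    rw [fac hX, fac hY]
    exact ind.comp Measurable.of_discrete Measurable.of_discrete
  exact hXY.integral_fun_mul_eq_mul_integral
    (Measurable.of_discrete (f := X)).aestronglyMeasurable
    (Measurable.of_discrete (f := Y)).aestronglyMeasurable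

open Classical in
/-- Indicator that all vertices of `S` have color `i`. -/
noncomputable def allColor (S : Finset V) (i : Fin p) (k : V → Fin p) : ℝ :=
  if ∀ v ∈ S, k v = i then 1 else 0

lemma dependsOn_allColor (S : Finset V) (i : Fin p) : DependsOn (allColor S i) S := by
  intro k l h
  unfold allColor
  congr 1
  exact propext (forall₂_congr fun v hv => by rw [h v hv])

lemma allColor_nonneg (S : Finset V) (i : Fin p) (k : V → Fin p) : 0 ≤ allColor S i k := by
  unfold allColor; split_ifs <;> simp

lemma allColor_mul_allColor [DecidableEq V] (S T : Finset V) (i : Fin p) (k : V → Fin p) :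
    allColor S i k * allColor T i k = allColor (S ∪ T) i k := by
  have : (∀ v ∈ S ∪ T, k v = i) ↔ (∀ v ∈ S, k v = i) ∧ ∀ v ∈ T, k v = i := by
    simp only [Finset.mem_union, or_imp, forall_and]
  unfold allColor
  by_cases h1 : ∀ v ∈ S, k v = i
  · by_cases h2 : ∀ v ∈ T, k v = i
    · rw [if_pos h1, if_pos h2, if_pos (this.2 ⟨h1, h2⟩), one_mul]
    · rw [if_neg h2, if_neg fun h => h2 (this.1 h).2, mul_zero]
  · rw [if_neg h1, if_neg fun h => h1 (this.1 h).1, zero_mul]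

lemma allColor_mul_allColor_of_ne {S T : Finset V} (hST : ¬Disjoint S T) {i j : Fin p}
    (hij : i ≠ j) (k : V → Fin p) : allColor S i k * allColor T j k = 0 := by
  obtain ⟨v, hS, hT⟩ := Finset.not_disjoint_iff.1 hST
  unfold allColor
  by_cases h1 : ∀ v ∈ S, k v = i
  · have h2 : ¬∀ v ∈ T, k v = j := fun h2 => hij ((h1 v hS).symm.trans (h2 v hT))
    rw [if_neg h2, mul_zero]
  · rw [if_neg h1, zero_mul]

lemma sum_allColor_singleton (v : V) (k : V → Fin p) : ∑ i, allColor {v} i k = 1 := by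
  simp [allColor]

lemma sum_allColor_le_one {S : Finset V} (hS : S.Nonempty) (k : V → Fin p) :
    ∑ i, allColor S i k ≤ 1 := by
  obtain ⟨v, hv⟩ := hS
  rw [← sum_allColor_singleton v k]
  refine Finset.sum_le_sum fun i _ => ?_
  simp only [allColor, Finset.mem_singleton, forall_eq]
  split_ifs with h1 h2 h2
  · exact le_rfl
  · exact absurd (h1 v hv) h2
  · exact zero_le_one
  · exact le_rfl

lemma IsIndepColoring.integral_allColor
    (hc : IsIndepColoring P π fun v (k : V → Fin p) => k v) (S : Finset V) (i : Fin p) :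
    ∫ k, allColor S i k ∂P = π i ^ S.card := by
  classical
  induction S using Finset.induction_on with
  | empty => simp [allColor]
  | insert a S ha ih =>
    have h1 : ∀ k : V → Fin p, allColor (insert a S) i k = allColor {a} i k * allColor S i k :=
      fun k => by rw [allColor_mul_allColor, Finset.singleton_union]
    have h2 : ∫ k, allColor {a} i k ∂P = π i := by
      rw [← hc.prob a i, ← integral_indicator_one (Set.toFinite _).measurableSet]
      congr 1
      funext k
      simp [allColor, Set.indicator_apply]
    simp only [h1]
    rw [hc.integral_mul_of_dependsOn (dependsOn_allColor {a} i) (dependsOn_allColor S i)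
      (by simpa using ha), ih, h2, Finset.card_insert_of_notMem ha, pow_succ, mul_comm]

/-- Some vertex exists and it receives some color, so the total mass 1 need not be assumed. -/
lemma IsIndepColoring.sum_eq_one [Nonempty V]
    (hc : IsIndepColoring P π fun v (k : V → Fin p) => k v) : ∑ i, π i = 1 := by
  obtain ⟨v⟩ := ‹Nonempty V›
  have h1 : ∀ i, π i = ∫ k, allColor {v} i k ∂P := fun i => by simp [hc.integral_allColor {v} i]
  simp only [h1]
  rw [← integral_finsetSum _ fun i _ => Integrable.of_finite]
  simp [sum_allColor_singleton]

/-- Variance bound for a sum of bounded functions with a dependency structure. -/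
lemma IsIndepColoring.integral_sq_sum_sub_le [DecidableEq V]
    (hc : IsIndepColoring P π fun v (k : V → Fin p) => k v)
    {ι : Type*} (I : Finset ι) (X : ι → (V → Fin p) → ℝ) (S : ι → Finset V) {C : ℝ}
    (hX : ∀ a ∈ I, DependsOn (X a) (S a)) (hC : ∀ a ∈ I, ∀ k, |X a k| ≤ C) :
    ∫ k, (∑ a ∈ I, X a k - ∫ l, ∑ a ∈ I, X a l ∂P) ^ 2 ∂P ≤
      2 * C ^ 2 * ((I ×ˢ I).filter fun q => ¬Disjoint (S q.1) (S q.2)).card := by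
  have hfin : ∀ Z : (V → Fin p) → ℝ, Integrable Z P := fun Z => Integrable.of_finite
  have habs : ∀ Z : (V → Fin p) → ℝ, ∀ D : ℝ, (∀ k, |Z k| ≤ D) → |∫ k, Z k ∂P| ≤ D :=
    fun Z D hD => by
      simpa using norm_integral_le_of_norm_le_const (μ := P) (f := Z) (Eventually.of_forall hD)
  have hsum : ∫ l, ∑ a ∈ I, X a l ∂P = ∑ a ∈ I, ∫ l, X a l ∂P :=
    integral_finsetSum _ fun _ _ => hfin _
  have h1 : ∀ k, (∑ a ∈ I, X a k - ∫ l, ∑ a ∈ I, X a l ∂P) ^ 2 =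
      ∑ q ∈ I ×ˢ I, (X q.1 k - ∫ l, X q.1 l ∂P) * (X q.2 k - ∫ l, X q.2 l ∂P) := fun k => by
    rw [hsum, ← Finset.sum_sub_distrib, sq, Finset.sum_mul_sum, Finset.sum_product]
  have h2 : ∀ a b, ∫ k, (X a k - ∫ l, X a l ∂P) * (X b k - ∫ l, X b l ∂P) ∂P =
      ∫ k, X a k * X b k ∂P - (∫ l, X a l ∂P) * ∫ l, X b l ∂P := fun a b => by
    have : ∀ k, (X a k - ∫ l, X a l ∂P) * (X b k - ∫ l, X b l ∂P) =
      X a k * X b k - (∫ l, X a l ∂P) * X b k - (∫ l, X b l ∂P) * X a k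
        + (∫ l, X a l ∂P) * ∫ l, X b l ∂P := fun k => by ring
    simp only [this]
    rw [integral_add (hfin _) (hfin _), integral_sub (hfin _) (hfin _),
      integral_sub (hfin _) (hfin _), integral_const_mul, integral_const_mul]
    simp only [integral_const, probReal_univ, one_smul]
    ring
  simp only [h1]
  rw [integral_finsetSum _ fun _ _ => hfin _]
  simp only [h2]
  -- Pairs with disjoint supports have covariance zero; every other pair contributes at most 2C².
  rw [← Finset.sum_filter_add_sum_filter_not (I ×ˢ I) fun q => ¬Disjoint (S q.1) (S q.2)]
  have h3 : ∑ q ∈ (I ×ˢ I).filter (fun q => ¬¬Disjoint (S q.1) (S q.2)),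
      (∫ k, X q.1 k * X q.2 k ∂P - (∫ l, X q.1 l ∂P) * ∫ l, X q.2 l ∂P) = 0 := by
    refine Finset.sum_eq_zero fun q hq => ?_
    rw [Finset.mem_filter, Finset.mem_product, not_not] at hq
    rw [hc.integral_mul_of_dependsOn (hX _ hq.1.1) (hX _ hq.1.2) hq.2, sub_self]
  rw [h3, add_zero, mul_comm, ← nsmul_eq_mul]
  refine Finset.sum_le_card_nsmul _ _ _ fun q hq => ?_
  rw [Finset.mem_filter, Finset.mem_product] at hq
  have hC0 : 0 ≤ C := (abs_nonneg _).trans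
    (hC _ hq.1.1 (Classical.choice P.nonempty_of_neZero))
  have b1 : |∫ k, X q.1 k * X q.2 k ∂P| ≤ C * C := habs _ _ fun k => by
    rw [abs_mul]
    exact mul_le_mul (hC _ hq.1.1 k) (hC _ hq.1.2 k) (abs_nonneg _) hC0
  have b2 : |(∫ l, X q.1 l ∂P) * ∫ l, X q.2 l ∂P| ≤ C * C := by
    rw [abs_mul]
    exact mul_le_mul (habs _ _ (hC _ hq.1.1)) (habs _ _ (hC _ hq.1.2)) (abs_nonneg _) hC0
  have := (le_abs_self _).trans ((abs_sub _ _).trans (add_le_add b1 b2))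
  linarith [this]

/-- Nonnegativity of the variance of |Z|. -/
lemma sq_integral_abs_le (Z : (V → Fin p) → ℝ) : (∫ k, |Z k| ∂P) ^ 2 ≤ ∫ k, Z k ^ 2 ∂P := by
  have hfin : ∀ Z : (V → Fin p) → ℝ, Integrable Z P := fun Z => Integrable.of_finite
  set m := ∫ k, |Z k| ∂P with hm
  have h : 0 ≤ ∫ k, (|Z k| - m) ^ 2 ∂P := integral_nonneg fun k => sq_nonneg _
  have e : ∀ k, (|Z k| - m) ^ 2 = Z k ^ 2 - 2 * m * |Z k| + m ^ 2 := fun k => by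
    rw [sub_sq, sq_abs]; ring
  simp only [e] at h
  rw [integral_add (hfin _) (hfin _), integral_sub (hfin _) (hfin _), integral_const_mul, ← hm]
    at h
  simp only [integral_const, probReal_univ, one_smul] at h
  linarith

end Independence

/-! ### Counting touching edges and overlapping pairs of edges -/

section Counting

variable {V : Type*} [Fintype V] [DecidableEq V] (G : SimpleGraph V) [DecidableRel G.Adj] {d : ℕ}

/-- Edges sharing a vertex with `e`. -/
def edgeNbrs (e : Sym2 V) : Finset (Sym2 V) :=
  G.edgeFinset.filter fun e' => ¬Disjoint e.toFinset e'.toFinset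

/-- Ordered pairs of edges sharing a vertex. -/
def touchingPairs : Finset (Sym2 V × Sym2 V) :=
  (G.edgeFinset ×ˢ G.edgeFinset).filter fun q => ¬Disjoint q.1.toFinset q.2.toFinset

variable {G}

lemma card_toFinset_of_mem_edgeFinset {e : Sym2 V} (he : e ∈ G.edgeFinset) :
    e.toFinset.card = 2 :=
  Sym2.card_toFinset_of_not_isDiag e (G.not_isDiag_of_mem_edgeFinset he)

lemma mem_edgeNbrs_self {e : Sym2 V} (he : e ∈ G.edgeFinset) : e ∈ edgeNbrs G e := by
  refine Finset.mem_filter.2 ⟨he, ?_⟩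
  rw [disjoint_self]
  exact Sym2.toFinset_ne_empty e

lemma card_filter_mem_edge (hG : G.IsRegularOfDegree d) (v : V) :
    (G.edgeFinset.filter fun e => v ∈ e.toFinset).card = d := by
  rw [← hG v, ← SimpleGraph.card_incidenceFinset_eq_degree, SimpleGraph.incidenceFinset_eq_filter]
  simp only [Sym2.mem_toFinset]

/-- Each end of `e` lies on `d` edges, and the two families share only `e`, which counts as its own
neighbor. The `+ 1` avoids natural subtraction. -/
lemma card_edgeNbrs (hG : G.IsRegularOfDegree d) {e : Sym2 V} (he : e ∈ G.edgeFinset) :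
    (edgeNbrs G e).card + 1 = 2 * d := by
  induction e with
  | _ a b =>
    have hab : G.Adj a b := by simpa using he
    have h1 : edgeNbrs G s(a, b) = (G.edgeFinset.filter fun e => a ∈ e.toFinset) ∪
        G.edgeFinset.filter fun e => b ∈ e.toFinset := by
      rw [← Finset.filter_or]
      unfold edgeNbrs
      refine Finset.filter_congr fun e' _ => ?_
      rw [Sym2.toFinset_mk_eq, Finset.not_disjoint_iff]
      simp
    have h2 : (G.edgeFinset.filter fun e => a ∈ e.toFinset) ∩
        (G.edgeFinset.filter fun e => b ∈ e.toFinset) = {s(a, b)} := by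
      ext e'
      simp only [Finset.mem_inter, Finset.mem_filter, Sym2.mem_toFinset, Finset.mem_singleton]
      constructor
      · rintro ⟨⟨_, ha⟩, _, hb⟩
        exact (Sym2.mem_and_mem_iff hab.ne).1 ⟨ha, hb⟩
      · rintro rfl
        exact ⟨⟨he, by simp⟩, he, by simp⟩
    have h3 := Finset.card_union_add_card_inter
      (G.edgeFinset.filter fun e => a ∈ e.toFinset) (G.edgeFinset.filter fun e => b ∈ e.toFinset)
    rw [← h1, h2, Finset.card_singleton, card_filter_mem_edge hG, card_filter_mem_edge hG] at h3
    omega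

lemma numEdges_pos [Nonempty V] (hG : G.IsRegularOfDegree d) (hd : 1 ≤ d) : 0 < numEdges G := by
  obtain ⟨v⟩ := ‹Nonempty V›
  have h := card_filter_mem_edge hG v
  exact hd.trans (h ▸ Finset.card_filter_le _ _)

lemma sum_touchingPairs {M : Type*} [AddCommMonoid M] (f : Sym2 V → Sym2 V → M) :
    ∑ q ∈ touchingPairs G, f q.1 q.2 = ∑ e ∈ G.edgeFinset, ∑ e' ∈ edgeNbrs G e, f e e' := by
  simp only [touchingPairs, edgeNbrs, Finset.sum_filter, Finset.sum_product]

lemma card_touchingPairs_le (hG : G.IsRegularOfDegree d) :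
    (touchingPairs G).card ≤ numEdges G * (2 * d) := by
  have h := sum_touchingPairs (G := G) (fun _ _ => 1)
  rw [Finset.card_eq_sum_ones, h, numEdges, ← smul_eq_mul]
  refine Finset.sum_le_card_nsmul _ _ _ fun e he => ?_
  rw [← Finset.card_eq_sum_ones]
  have := card_edgeNbrs hG he
  omega

/-- If `v` lies on the first edge there are `d` choices for it and at most `2 * d` for the second;
swapping the pair handles the other case. -/
lemma card_touchingPairs_filter_mem_le (hG : G.IsRegularOfDegree d) (v : V) :
    ((touchingPairs G).filter fun q => v ∈ q.1.toFinset ∪ q.2.toFinset).card ≤ 4 * d ^ 2 := by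
  have key : ((touchingPairs G).filter fun q => v ∈ q.1.toFinset).card ≤ 2 * d ^ 2 := by
    have h : ((touchingPairs G).filter fun q => v ∈ q.1.toFinset).card =
        ∑ e ∈ G.edgeFinset.filter (fun e => v ∈ e.toFinset), (edgeNbrs G e).card := by
      rw [Finset.card_eq_sum_ones, Finset.sum_filter,
        sum_touchingPairs (fun e _ => if v ∈ e.toFinset then 1 else 0), Finset.sum_filter]
      refine Finset.sum_congr rfl fun e _ => ?_
      split_ifs <;> simp
    rw [h]
    calc _ ≤ (G.edgeFinset.filter fun e => v ∈ e.toFinset).card • (2 * d) :=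
          Finset.sum_le_card_nsmul _ _ _ fun e he => by
            have := card_edgeNbrs hG (Finset.mem_filter.1 he).1
            omega
      _ = 2 * d ^ 2 := by rw [card_filter_mem_edge hG, smul_eq_mul]; ring
  have key2 : ((touchingPairs G).filter fun q => v ∈ q.2.toFinset).card ≤ 2 * d ^ 2 := by
    refine le_trans (Finset.card_le_card_of_injOn Prod.swap (fun q hq => ?_)
      Prod.swap_injective.injOn) key
    simp only [touchingPairs, Finset.coe_filter, Finset.mem_filter, Finset.mem_product,
      Set.mem_ofPred_eq, Prod.fst_swap, Prod.snd_swap] at hq ⊢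
    exact ⟨⟨hq.1.1.symm, fun h => hq.1.2 h.symm⟩, hq.2⟩
  simp only [Finset.mem_union, Finset.filter_or]
  calc _ ≤ _ := Finset.card_union_le _ _
    _ ≤ 2 * d ^ 2 + 2 * d ^ 2 := add_le_add key key2
    _ = _ := by ring

/-- There are at most 2dN touching pairs; each covers at most 4 vertices, and each vertex is met by
at most 4d² pairs. The resulting d³ becomes d^{3/2} in the final bound after a square root. -/
lemma card_touchingPairs_overlap_le (hG : G.IsRegularOfDegree d) :
    ((touchingPairs G ×ˢ touchingPairs G).filter fun q =>
      ¬Disjoint (q.1.1.toFinset ∪ q.1.2.toFinset) (q.2.1.toFinset ∪ q.2.2.toFinset)).card ≤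
      32 * numEdges G * d ^ 3 := by
  have h1 : ∀ a ∈ touchingPairs G, ((touchingPairs G).filter fun b =>
      ¬Disjoint (a.1.toFinset ∪ a.2.toFinset) (b.1.toFinset ∪ b.2.toFinset)).card ≤
      16 * d ^ 2 := by
    intro a ha
    have hsub : ((touchingPairs G).filter fun b =>
        ¬Disjoint (a.1.toFinset ∪ a.2.toFinset) (b.1.toFinset ∪ b.2.toFinset)) ⊆
        (a.1.toFinset ∪ a.2.toFinset).biUnion fun v =>
          (touchingPairs G).filter fun q => v ∈ q.1.toFinset ∪ q.2.toFinset := by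
      intro b hb
      obtain ⟨hb1, hb2⟩ := Finset.mem_filter.1 hb
      obtain ⟨v, hv1, hv2⟩ := Finset.not_disjoint_iff.1 hb2
      exact Finset.mem_biUnion.2 ⟨v, hv1, Finset.mem_filter.2 ⟨hb1, hv2⟩⟩
    have hcard : (a.1.toFinset ∪ a.2.toFinset).card ≤ 4 := by
      have hm := Finset.mem_product.1 (Finset.mem_filter.1 ha).1
      refine (Finset.card_union_le _ _).trans ?_
      rw [card_toFinset_of_mem_edgeFinset hm.1, card_toFinset_of_mem_edgeFinset hm.2]
    calc _ ≤ _ := Finset.card_le_card hsub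
      _ ≤ _ := Finset.card_biUnion_le_card_mul _ _ _ fun v _ =>
        card_touchingPairs_filter_mem_le hG v
      _ ≤ 4 * (4 * d ^ 2) := Nat.mul_le_mul_right _ hcard
      _ = _ := by ring
  rw [Finset.card_filter, Finset.sum_product]
  simp only [← Finset.card_filter]
  calc _ ≤ (touchingPairs G).card • (16 * d ^ 2) := Finset.sum_le_card_nsmul _ _ _ h1
    _ ≤ (numEdges G * (2 * d)) * (16 * d ^ 2) :=
      Nat.mul_le_mul_right _ (card_touchingPairs_le hG)
    _ = _ := by ring

end Counting

/-! ### Mean and covariance of the counts -/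

section Moments

variable {V : Type*} [Fintype V] [DecidableEq V] {G : SimpleGraph V} [DecidableRel G.Adj] {d p : ℕ}
  {π : Fin p → ℝ} {P : Measure (V → Fin p)} [IsProbabilityMeasure P]

/-- The centered indicator that both ends of `e` have color `i`. -/
noncomputable def centeredMatch (π : Fin p → ℝ) (e : Sym2 V) (i : Fin p) (k : V → Fin p) : ℝ :=
  allColor e.toFinset i k - π i ^ 2

lemma dependsOn_centeredMatch (π : Fin p → ℝ) (e : Sym2 V) (i : Fin p) :
    DependsOn (centeredMatch π e i) e.toFinset := fun k l h => by
  rw [centeredMatch, centeredMatch, dependsOn_allColor _ _ h]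

lemma monoCount_eq_sum {Ω : Type*} (c : V → Ω → Fin p) (i : Fin p) (ω : Ω) :
    (monoCount G c i ω : ℝ) = ∑ e ∈ G.edgeFinset, allColor e.toFinset i fun v => c v ω := by
  simp [monoCount, allColor]

lemma monoCount_sub_meanVec {Ω : Type*} (c : V → Ω → Fin p) (i : Fin p) (ω : Ω) :
    (monoCount G c i ω : ℝ) - meanVec G π i =
      ∑ e ∈ G.edgeFinset, centeredMatch π e i fun v => c v ω := by
  simp [monoCount_eq_sum, centeredMatch, meanVec, numEdges]

variable (hc : IsIndepColoring P π fun v (k : V → Fin p) => k v)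

include hc

lemma integral_centeredMatch {e : Sym2 V} (he : e ∈ G.edgeFinset) (i : Fin p) :
    ∫ k, centeredMatch π e i k ∂P = 0 := by
  unfold centeredMatch
  rw [integral_sub Integrable.of_finite Integrable.of_finite, hc.integral_allColor,
    card_toFinset_of_mem_edgeFinset he]
  simp

lemma integral_centeredMatch_mul {e e' : Sym2 V} (he : e ∈ G.edgeFinset)
    (he' : e' ∈ G.edgeFinset) (i j : Fin p) :
    ∫ k, centeredMatch π e i k * centeredMatch π e' j k ∂P =
      ∫ k, allColor e.toFinset i k * allColor e'.toFinset j k ∂P - π i ^ 2 * π j ^ 2 := by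
  have hfin : ∀ Z : (V → Fin p) → ℝ, Integrable Z P := fun Z => Integrable.of_finite
  have e1 : ∀ k, centeredMatch π e i k * centeredMatch π e' j k =
      allColor e.toFinset i k * allColor e'.toFinset j k - π j ^ 2 * allColor e.toFinset i k
        - π i ^ 2 * allColor e'.toFinset j k + π i ^ 2 * π j ^ 2 := fun k => by
    unfold centeredMatch; ring
  simp only [e1]
  rw [integral_add (hfin _) (hfin _), integral_sub (hfin _) (hfin _),
    integral_sub (hfin _) (hfin _), integral_const_mul, integral_const_mul,
    hc.integral_allColor, hc.integral_allColor, card_toFinset_of_mem_edgeFinset he,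
    card_toFinset_of_mem_edgeFinset he']
  simp only [integral_const, probReal_univ, one_smul]
  ring

lemma integral_centeredMatch_mul_of_disjoint {e e' : Sym2 V} (he : e ∈ G.edgeFinset)
    (h : Disjoint e.toFinset e'.toFinset) (i j : Fin p) :
    ∫ k, centeredMatch π e i k * centeredMatch π e' j k ∂P = 0 := by
  rw [hc.integral_mul_of_dependsOn (dependsOn_centeredMatch π e i) (dependsOn_centeredMatch π e' j)
    h, integral_centeredMatch hc he, zero_mul]

/-- For equal colors, `e` with itself gives π_i², and each of the 2d − 2 other neighbors meets `e`
in exactly one vertex, so three vertices must agree and give π_i³. For distinct colors a shared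
vertex makes the product vanish. Centering is subtracted 2d − 1 times. -/
lemma sum_edgeNbrs_integral (hG : G.IsRegularOfDegree d) {e : Sym2 V} (he : e ∈ G.edgeFinset)
    (i j : Fin p) :
    ∑ e' ∈ edgeNbrs G e, ∫ k, centeredMatch π e i k * centeredMatch π e' j k ∂P =
      (if i = j then π i ^ 2 + 2 * ((d : ℝ) - 1) * π i ^ 3 else 0)
      - (2 * (d : ℝ) - 1) * (π i ^ 2 * π j ^ 2) := by
  have hnb : ∀ e' ∈ edgeNbrs G e, e' ∈ G.edgeFinset ∧ ¬Disjoint e.toFinset e'.toFinset :=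
    fun e' he' => Finset.mem_filter.1 he'
  have hcard : ((edgeNbrs G e).card : ℝ) = 2 * d - 1 := by
    have : ((edgeNbrs G e).card : ℝ) + 1 = 2 * d := by exact_mod_cast card_edgeNbrs hG he
    linarith
  rw [Finset.sum_congr rfl fun e' he' =>
    integral_centeredMatch_mul hc he (hnb e' he').1 i j, Finset.sum_sub_distrib,
    Finset.sum_const, nsmul_eq_mul, hcard]
  congr 1
  by_cases hij : i = j
  · subst hij
    simp only [allColor_mul_allColor, hc.integral_allColor, if_true]
    rw [← Finset.add_sum_erase _ _ (mem_edgeNbrs_self he)]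
    have h3 : ∀ e' ∈ (edgeNbrs G e).erase e, π i ^ (e.toFinset ∪ e'.toFinset).card = π i ^ 3 := by
      intro e' he'
      obtain ⟨hne, hm⟩ := Finset.mem_erase.1 he'
      obtain ⟨he'E, hnd⟩ := hnb e' hm
      congr 1
      have hu := Finset.card_union_add_card_inter e.toFinset e'.toFinset
      rw [card_toFinset_of_mem_edgeFinset he, card_toFinset_of_mem_edgeFinset he'E] at hu
      have h0 : 0 < (e.toFinset ∩ e'.toFinset).card := by
        rw [Finset.card_pos, Finset.nonempty_iff_ne_empty, Ne, ← Finset.disjoint_iff_inter_eq_empty]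
        exact hnd
      have h2 : (e.toFinset ∩ e'.toFinset).card < 2 := by
        by_contra! hge
        refine hne ?_
        have s1 : e.toFinset ∩ e'.toFinset = e.toFinset :=
          Finset.eq_of_subset_of_card_le Finset.inter_subset_left
            (by rw [card_toFinset_of_mem_edgeFinset he]; exact hge)
        have s2 : e.toFinset ∩ e'.toFinset = e'.toFinset :=
          Finset.eq_of_subset_of_card_le Finset.inter_subset_right
            (by rw [card_toFinset_of_mem_edgeFinset he'E]; exact hge)
        refine Sym2.ext fun v => ?_
        rw [← Sym2.mem_toFinset, ← Sym2.mem_toFinset, ← s1, s2]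
      omega
    rw [Finset.sum_congr rfl h3, Finset.sum_const, nsmul_eq_mul,
      Finset.card_erase_of_mem (mem_edgeNbrs_self he),
      Nat.cast_sub (Finset.card_pos.2 ⟨e, mem_edgeNbrs_self he⟩), hcard, Finset.union_self,
      card_toFinset_of_mem_edgeFinset he]
    push_cast
    ring
  · rw [if_neg hij]
    refine Finset.sum_eq_zero fun e' he' => ?_
    simp only [allColor_mul_allColor_of_ne (hnb e' he').2 hij, integral_zero]

lemma integral_sum_mul_sum_centeredMatch (hG : G.IsRegularOfDegree d) (i j : Fin p) :
    ∫ k, (∑ e ∈ G.edgeFinset, centeredMatch π e i k) *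
      (∑ e ∈ G.edgeFinset, centeredMatch π e j k) ∂P = covMatrix G d π i j := by
  simp only [Finset.sum_mul_sum]
  rw [integral_finsetSum _ fun _ _ => Integrable.of_finite, covMatrix_apply, numEdges,
    ← nsmul_eq_mul]
  refine Finset.sum_eq_card_nsmul fun e he => ?_
  rw [integral_finsetSum _ fun _ _ => Integrable.of_finite, ← sum_edgeNbrs_integral hc hG he i j]
  refine (Finset.sum_subset (Finset.filter_subset _ _) fun e' he' hn => ?_).symm
  refine integral_centeredMatch_mul_of_disjoint hc he ?_ i j
  by_contra h
  exact hn (Finset.mem_filter.2 ⟨he', h⟩)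

end Moments

/-! ### Gaussian interpolation -/

section Interpolation

variable {p : ℕ} {h : (Fin p → ℝ) → ℝ}

/-- Comparison with the standard normal law by Gaussian interpolation. -/
lemma HasBoundedPartials.abs_integral_sub_le (H : HasBoundedPartials h) {K : Type*} [Finite K]
    [MeasurableSpace K] [MeasurableSingletonClass K] {P : Measure K} [IsProbabilityMeasure P]
    (T : K → Fin p → ℝ) {C : ℝ}
    (hC : ∀ s c : ℝ, |s| ≤ 1 →
      |∫ k, ∑ i, T k i * gaussSmooth (partialDeriv i h) s c (T k) ∂P
        - s * ∫ k, ∑ i, gaussSmooth (partialDeriv i (partialDeriv i h)) s c (T k) ∂P| ≤ C) :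
    |∫ k, h (T k) ∂P - ∫ z, h z ∂stdNormal p| ≤ 2 * C := by
  cases nonempty_fintype K
  have hfin : ∀ Z : K → ℝ, Integrable Z P := fun Z => Integrable.of_finite
  -- With the trigonometric parametrization the derivative carries no singular factor at either
  -- endpoint.
  set F : ℝ → ℝ := fun θ => ∫ k, gaussSmooth h (Real.sin θ) (Real.cos θ) (T k) ∂P with hF
  set F' : ℝ → ℝ := fun θ => Real.cos θ *
    (∫ k, ∑ i, T k i * gaussSmooth (partialDeriv i h) (Real.sin θ) (Real.cos θ) (T k) ∂P
      - Real.sin θ * ∫ k, ∑ i, gaussSmooth (partialDeriv i (partialDeriv i h))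
        (Real.sin θ) (Real.cos θ) (T k) ∂P) with hF'
  have hd : ∀ θ, HasDerivAt F (F' θ) θ := fun θ => by
    have h1 : HasDerivAt (fun θ => ∑ k, P.real {k} •
        gaussSmooth h (Real.sin θ) (Real.cos θ) (T k)) _ θ :=
      HasDerivAt.fun_sum fun k _ => (H.hasDerivAt_gaussSmooth (T k) θ).const_smul (P.real {k})
    have h2 : F = fun θ => ∑ k, P.real {k} • gaussSmooth h (Real.sin θ) (Real.cos θ) (T k) :=
      funext fun θ => integral_fintype (hfin _)
    rw [h2]
    refine h1.congr_deriv ?_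
    rw [← integral_fintype (hfin fun k => _)]
    simp only [hF']
    rw [integral_sub (hfin _) (hfin _), integral_const_mul, integral_const_mul]
    ring
  have hb : ∀ θ, ‖F' θ‖ ≤ C := fun θ => by
    rw [Real.norm_eq_abs, abs_mul]
    exact (mul_le_of_le_one_left (abs_nonneg _) (Real.abs_cos_le_one θ)).trans
      (hC _ _ (Real.abs_sin_le_one θ))
  have h0 : F 0 = ∫ z, h z ∂stdNormal p := by simp [hF, gaussSmooth]
  have h1 : F (Real.pi / 2) = ∫ k, h (T k) ∂P := by simp [hF, gaussSmooth]
  have hC0 : 0 ≤ C := (norm_nonneg _).trans (hb 0)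
  have main := convex_univ.norm_image_sub_le_of_norm_hasDerivWithin_le
    (fun θ _ => (hd θ).hasDerivWithinAt) (fun θ _ => hb θ) (Set.mem_univ (0 : ℝ))
    (Set.mem_univ (Real.pi / 2))
  rw [h0, h1, sub_zero, Real.norm_eq_abs, Real.norm_eq_abs, abs_of_pos Real.pi_div_two_pos] at main
  rw [mul_comm 2]
  -- The factor 2 bounds the length π/2 of the path.
  exact main.trans (mul_le_mul_of_nonneg_left (by linarith [Real.pi_le_four]) hC0)

end Interpolation

/-! ### Local dependence and the approximate Stein identity -/

section Bound

variable {V : Type*} [Fintype V] [DecidableEq V] {p : ℕ}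

/-- The contribution of the edge `e` to `Σ^{-1/2} (W - λ)`. -/
noncomputable def stdTerm (G : SimpleGraph V) [DecidableRel G.Adj] (d : ℕ) (π : Fin p → ℝ)
    (e : Sym2 V) (i : Fin p) (k : V → Fin p) : ℝ :=
  ∑ l, invSqrt (covMatrix G d π) i l * centeredMatch π e l k

/-- The contribution of the edges touching `e`. -/
noncomputable def nbrTerm (G : SimpleGraph V) [DecidableRel G.Adj] (d : ℕ) (π : Fin p → ℝ)
    (e : Sym2 V) (i : Fin p) (k : V → Fin p) : ℝ :=
  ∑ e' ∈ edgeNbrs G e, stdTerm G d π e' i k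

/-- The standard deviation scale `√(2B/N)`. -/
noncomputable def scale (G : SimpleGraph V) [DecidableRel G.Adj] (π : Fin p → ℝ) : ℝ :=
  √(2 * constB π / numEdges G)

variable {G : SimpleGraph V} [DecidableRel G.Adj] {d : ℕ} {π : Fin p → ℝ}

omit [DecidableEq V] in
lemma scale_nonneg : 0 ≤ scale G π := Real.sqrt_nonneg _

lemma dependsOn_stdTerm (e : Sym2 V) (i : Fin p) : DependsOn (stdTerm G d π e i) e.toFinset :=
  fun k l h => by
    simp only [stdTerm]
    exact Finset.sum_congr rfl fun m _ => by rw [dependsOn_centeredMatch π e m h]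

lemma standardizedCount_apply {Ω : Type*} (c : V → Ω → Fin p) (ω : Ω) (i : Fin p) :
    standardizedCount G d π c ω i = ∑ e ∈ G.edgeFinset, stdTerm G d π e i fun v => c v ω := by
  simp only [standardizedCount, Matrix.mulVec, dotProduct, monoCount_sub_meanVec, stdTerm,
    Finset.mul_sum]
  exact Finset.sum_comm

/-- No factor `p` is lost: at most one color matches on an edge and ∑ π_l² ≤ 1, so the centered
indicators have total absolute value at most 2. -/
lemma abs_stdTerm_le (hN : 0 < numEdges G) (hd : 1 ≤ d) (hπ : ∀ i, 0 < π i ∧ π i < 1)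
    (hsum : ∑ i, π i = 1) {e : Sym2 V} (i : Fin p) (k : V → Fin p) :
    |stdTerm G d π e i k| ≤ 2 * scale G π := by
  have h1 : ∀ l, |invSqrt (covMatrix G d π) i l| ≤ scale G π := fun l => by
    refine Real.abs_le_sqrt (le_trans ?_ (sum_invSqrt_sq_le hN hd hπ hsum i))
    exact Finset.single_le_sum (f := fun l => invSqrt (covMatrix G d π) i l ^ 2)
      (fun l _ => sq_nonneg _) (Finset.mem_univ l)
  have h2 : ∑ l, |centeredMatch π e l k| ≤ 2 := by
    calc ∑ l, |centeredMatch π e l k| ≤ ∑ l, (allColor e.toFinset l k + π l) := by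
          refine Finset.sum_le_sum fun l _ => (abs_sub _ _).trans ?_
          rw [abs_of_nonneg (allColor_nonneg _ _ _), abs_of_nonneg (sq_nonneg _)]
          have : π l ^ 2 ≤ π l := by nlinarith [(hπ l).1, (hπ l).2]
          linarith
      _ ≤ 1 + 1 := by
          rw [Finset.sum_add_distrib, hsum]
          have := sum_allColor_le_one (p := p)
            (Finset.nonempty_iff_ne_empty.2 (Sym2.toFinset_ne_empty e)) k
          linarith
      _ = 2 := by norm_num
  calc |stdTerm G d π e i k| ≤ ∑ l, scale G π * |centeredMatch π e l k| := by
        refine (Finset.abs_sum_le_sum_abs _ _).trans (Finset.sum_le_sum fun l _ => ?_)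
        rw [abs_mul]
        exact mul_le_mul_of_nonneg_right (h1 l) (abs_nonneg _)
    _ ≤ 2 * scale G π := by
        rw [← Finset.mul_sum, mul_comm]
        exact mul_le_mul_of_nonneg_right h2 scale_nonneg

lemma abs_nbrTerm_le (hG : G.IsRegularOfDegree d) (hN : 0 < numEdges G) (hd : 1 ≤ d)
    (hπ : ∀ i, 0 < π i ∧ π i < 1) (hsum : ∑ i, π i = 1) {e : Sym2 V} (he : e ∈ G.edgeFinset)
    (i : Fin p) (k : V → Fin p) : |nbrTerm G d π e i k| ≤ 4 * d * scale G π := by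
  have hcard : ((edgeNbrs G e).card : ℝ) ≤ 2 * d := by
    have := card_edgeNbrs hG he
    exact_mod_cast (by omega : (edgeNbrs G e).card ≤ 2 * d)
  calc |nbrTerm G d π e i k| ≤ ∑ e' ∈ edgeNbrs G e, |stdTerm G d π e' i k| :=
        Finset.abs_sum_le_sum_abs _ _
    _ ≤ (edgeNbrs G e).card • (2 * scale G π) :=
        Finset.sum_le_card_nsmul _ _ _ fun e' _ => abs_stdTerm_le hN hd hπ hsum i k
    _ ≤ (2 * d) * (2 * scale G π) := by
        rw [nsmul_eq_mul]
        exact mul_le_mul_of_nonneg_right hcard (mul_nonneg zero_le_two scale_nonneg)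
    _ = _ := by ring

variable {P : Measure (V → Fin p)} [IsProbabilityMeasure P]

lemma integral_stdTerm (hc : IsIndepColoring P π fun v (k : V → Fin p) => k v) {e : Sym2 V}
    (he : e ∈ G.edgeFinset) (i : Fin p) : ∫ k, stdTerm G d π e i k ∂P = 0 := by
  unfold stdTerm
  rw [integral_finsetSum _ fun _ _ => Integrable.of_finite]
  simp [integral_const_mul, integral_centeredMatch hc he]

lemma integral_stdTerm_mul_of_disjoint (hc : IsIndepColoring P π fun v (k : V → Fin p) => k v)
    {e : Sym2 V} (he : e ∈ G.edgeFinset) (i : Fin p) {S : Finset V} {Y : (V → Fin p) → ℝ}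
    (hY : DependsOn Y S) (hS : Disjoint e.toFinset S) :
    ∫ k, stdTerm G d π e i k * Y k ∂P = 0 := by
  rw [hc.integral_mul_of_dependsOn (dependsOn_stdTerm e i) hY hS, integral_stdTerm hc he, zero_mul]

/-- Non-touching edges are uncorrelated, so restricting the second factor to neighbors loses
nothing: the result is the full covariance Σ^{-1/2} Σ Σ^{-1/2}. -/
lemma integral_sum_stdTerm_mul_nbrTerm (hc : IsIndepColoring P π fun v (k : V → Fin p) => k v)
    (hG : G.IsRegularOfDegree d) (hS : (covMatrix G d π).PosDef) (i j : Fin p) :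
    ∫ k, ∑ e ∈ G.edgeFinset, stdTerm G d π e i k * nbrTerm G d π e j k ∂P =
      if i = j then 1 else 0 := by
  have hfin : ∀ Z : (V → Fin p) → ℝ, Integrable Z P := fun Z => Integrable.of_finite
  set A := invSqrt (covMatrix G d π) with hA
  have h1 : ∫ k, ∑ e ∈ G.edgeFinset, stdTerm G d π e i k * nbrTerm G d π e j k ∂P =
      ∫ k, (∑ e ∈ G.edgeFinset, stdTerm G d π e i k) *
        (∑ e ∈ G.edgeFinset, stdTerm G d π e j k) ∂P := by
    simp only [Finset.sum_mul_sum]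
    simp only [nbrTerm, Finset.mul_sum]
    rw [integral_finsetSum _ fun _ _ => hfin _, integral_finsetSum _ fun _ _ => hfin _]
    refine Finset.sum_congr rfl fun e he => ?_
    rw [integral_finsetSum _ fun _ _ => hfin _, integral_finsetSum _ fun _ _ => hfin _]
    refine Finset.sum_subset (Finset.filter_subset _ _) fun e' he' hn => ?_
    refine integral_stdTerm_mul_of_disjoint hc he i (dependsOn_stdTerm e' j) ?_
    by_contra h
    exact hn (Finset.mem_filter.2 ⟨he', h⟩)
  have h2 : ∀ i k, ∑ e ∈ G.edgeFinset, stdTerm G d π e i k =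
      ∑ l, A i l * ∑ e ∈ G.edgeFinset, centeredMatch π e l k := fun i k => by
    simp only [stdTerm, Finset.mul_sum]
    exact Finset.sum_comm
  have h3 : ∀ k, (∑ e ∈ G.edgeFinset, stdTerm G d π e i k) *
      (∑ e ∈ G.edgeFinset, stdTerm G d π e j k) = ∑ l, ∑ m, (A i l * A j m) *
        ((∑ e ∈ G.edgeFinset, centeredMatch π e l k) *
          ∑ e ∈ G.edgeFinset, centeredMatch π e m k) := fun k => by
    rw [h2, h2, Finset.sum_mul_sum]
    exact Finset.sum_congr rfl fun l _ => Finset.sum_congr rfl fun m _ => by ring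
  rw [h1]
  simp only [h3]
  rw [integral_finsetSum _ fun _ _ => hfin _, ← Matrix.one_apply, ← invSqrt_mul_mul_invSqrt hS,
    ← hA]
  have h4 : ∀ l, ∫ k, ∑ m, (A i l * A j m) * ((∑ e ∈ G.edgeFinset, centeredMatch π e l k) *
      ∑ e ∈ G.edgeFinset, centeredMatch π e m k) ∂P =
      ∑ m, A i l * covMatrix G d π l m * A m j := fun l => by
    rw [integral_finsetSum _ fun _ _ => hfin _]
    refine Finset.sum_congr rfl fun m _ => ?_
    rw [integral_const_mul, integral_sum_mul_sum_centeredMatch hc hG, hA,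
      invSqrt_symm (covMatrix G d π) m j]
    ring
  simp only [h4]
  simp only [Matrix.mul_apply, Finset.sum_mul]
  exact Finset.sum_comm

/-- The subtracted constant is the exact mean, so the L² norm bounds the L¹ norm by a standard
deviation. With r = `scale G π`, the variance is at most 2 (4r²)² · 32 N d³ = (32 r²)² N d³. -/
lemma integral_abs_sum_stdTerm_mul_nbrTerm_sub_le
    (hc : IsIndepColoring P π fun v (k : V → Fin p) => k v)
    (hG : G.IsRegularOfDegree d) (hN : 0 < numEdges G) (hd : 1 ≤ d)
    (hπ : ∀ i, 0 < π i ∧ π i < 1) (hsum : ∑ i, π i = 1) (i j : Fin p) :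
    ∫ k, |∑ e ∈ G.edgeFinset, stdTerm G d π e i k * nbrTerm G d π e j k
      - if i = j then 1 else 0| ∂P ≤ 32 * scale G π ^ 2 * √(numEdges G * (d : ℝ) ^ 3) := by
  have hr : 0 ≤ scale G π := scale_nonneg
  have e1 : ∀ k, ∑ e ∈ G.edgeFinset, stdTerm G d π e i k * nbrTerm G d π e j k =
      ∑ q ∈ touchingPairs G, stdTerm G d π q.1 i k * stdTerm G d π q.2 j k := fun k => by
    rw [sum_touchingPairs fun e e' => stdTerm G d π e i k * stdTerm G d π e' j k]
    simp only [nbrTerm, Finset.mul_sum]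
  have hmean := integral_sum_stdTerm_mul_nbrTerm hc hG (covMatrix_posDef hN hd hπ hsum) i j
  rw [← hmean]
  simp only [e1]
  have hv := hc.integral_sq_sum_sub_le (touchingPairs G)
    (fun q k => stdTerm G d π q.1 i k * stdTerm G d π q.2 j k)
    (fun q => q.1.toFinset ∪ q.2.toFinset) (C := 4 * scale G π ^ 2)
    (fun q _ k l hkl => by
      simp only [Finset.coe_union] at hkl
      simp only [dependsOn_stdTerm q.1 i fun v hv => hkl v (Or.inl hv),
        dependsOn_stdTerm q.2 j fun v hv => hkl v (Or.inr hv)])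
    (fun q _ k => by
      rw [abs_mul]
      calc _ ≤ (2 * scale G π) * (2 * scale G π) :=
            mul_le_mul (abs_stdTerm_le hN hd hπ hsum i k) (abs_stdTerm_le hN hd hπ hsum j k)
              (abs_nonneg _) (by positivity)
        _ = _ := by ring)
  have hcard : (((touchingPairs G ×ˢ touchingPairs G).filter fun q =>
      ¬Disjoint (q.1.1.toFinset ∪ q.1.2.toFinset) (q.2.1.toFinset ∪ q.2.2.toFinset)).card : ℝ) ≤
      32 * numEdges G * (d : ℝ) ^ 3 := by
    exact_mod_cast card_touchingPairs_overlap_le hG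
  refine (pow_le_pow_iff_left₀ (integral_nonneg fun _ => abs_nonneg _) (by positivity)
    two_ne_zero).1 ?_
  refine (sq_integral_abs_le _).trans (hv.trans ?_)
  rw [mul_pow (32 * scale G π ^ 2), Real.sq_sqrt (by positivity)]
  calc _ ≤ 2 * (4 * scale G π ^ 2) ^ 2 * (32 * numEdges G * (d : ℝ) ^ 3) :=
        mul_le_mul_of_nonneg_left hcard (by positivity)
    _ = _ := by ring

/-- Approximate Stein identity for the standardized counts. -/
lemma abs_stein_defect_le {h : (Fin p → ℝ) → ℝ} (H : HasBoundedPartials h)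
    (hc : IsIndepColoring P π fun v (k : V → Fin p) => k v)
    (hG : G.IsRegularOfDegree d) (hN : 0 < numEdges G) (hd : 1 ≤ d)
    (hπ : ∀ i, 0 < π i ∧ π i < 1) (hsum : ∑ i, π i = 1)
    (T : (V → Fin p) → Fin p → ℝ) (hT : ∀ k i, T k i = ∑ e ∈ G.edgeFinset, stdTerm G d π e i k)
    {s : ℝ} (hs : |s| ≤ 1) (c : ℝ) :
    |∫ k, ∑ i, T k i * gaussSmooth (partialDeriv i h) s c (T k) ∂P
        - s * ∫ k, ∑ i, gaussSmooth (partialDeriv i (partialDeriv i h)) s c (T k) ∂P| ≤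
      p ^ 2 * (normD2 h * (32 * scale G π ^ 2 * √(numEdges G * (d : ℝ) ^ 3))) +
      p * (numEdges G * (2 * scale G π * ((p * (4 * d * scale G π)) ^ 2 * normD3 h))) := by
  have hr : 0 ≤ scale G π := scale_nonneg
  have hD3 : 0 ≤ normD3 h := normD3_nonneg
  have hfin : ∀ Z : (V → Fin p) → ℝ, Integrable Z P := fun Z => Integrable.of_finite
  set g : Fin p → (V → Fin p) → ℝ := fun i k => gaussSmooth (partialDeriv i h) s c (T k) with hg
  set gg : Fin p → Fin p → (V → Fin p) → ℝ :=
    fun i j k => gaussSmooth (partialDeriv j (partialDeriv i h)) s c (T k) with hgg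
  set b : Sym2 V → (V → Fin p) → Fin p → ℝ := fun e k j => nbrTerm G d π e j k with hb
  -- The Taylor remainder of the smoothed partial derivative when the neighborhood of `e` is removed
  -- from `T k`.
  set R : Sym2 V → Fin p → (V → Fin p) → ℝ := fun e i k =>
    gaussSmooth (partialDeriv i h) s c (T k + -b e k) - g i k
      - s * ∑ j, (-b e k) j * gg i j k with hR
  have hRb : ∀ e ∈ G.edgeFinset, ∀ i k, |R e i k| ≤ (p * (4 * d * scale G π)) ^ 2 * normD3 h := by
    intro e he i k
    refine (H.abs_gaussSmooth_taylor_le i s c (T k) (-b e k)).trans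
      (mul_le_mul_of_nonneg_right ?_ hD3)
    have h1 : ∑ j, |(-b e k) j| ≤ p * (4 * d * scale G π) := by
      have := Finset.sum_le_card_nsmul Finset.univ (fun j => |(-b e k) j|) (4 * d * scale G π)
        fun j _ => by
          simp only [Pi.neg_apply, abs_neg]
          exact abs_nbrTerm_le hG hN hd hπ hsum he j k
      simpa using this
    have h2 : s ^ 2 ≤ 1 := (sq_le_one_iff_abs_le_one s).2 hs
    calc _ ≤ 1 * (p * (4 * d * scale G π)) ^ 2 :=
          mul_le_mul h2 (pow_le_pow_left₀ (Finset.sum_nonneg fun _ _ => abs_nonneg _) h1 2)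
            (sq_nonneg _) zero_le_one
      _ = _ := one_mul _
  -- After the neighborhood is removed, only edges disjoint from `e` remain. The second factor thus
  -- depends on vertices off `e`, while the first has mean zero.
  have hzero : ∀ e ∈ G.edgeFinset, ∀ i, ∫ k, stdTerm G d π e i k *
      gaussSmooth (partialDeriv i h) s c (T k + -b e k) ∂P = 0 := by
    intro e he i
    refine integral_stdTerm_mul_of_disjoint hc he i (S := e.toFinsetᶜ) (fun k l hkl => ?_)
      disjoint_compl_right
    congr 1
    funext j
    have h1 : ∀ k, (T k + -b e k) j = ∑ e' ∈ G.edgeFinset \ edgeNbrs G e, stdTerm G d π e' j k :=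
      fun k => by
        have := Finset.sum_sdiff (f := fun e' => stdTerm G d π e' j k)
          (Finset.filter_subset (fun e' => ¬Disjoint e.toFinset e'.toFinset) G.edgeFinset)
        simp only [Pi.add_apply, Pi.neg_apply, hT, hb, nbrTerm]
        rw [← this, edgeNbrs, add_neg_cancel_right]
    rw [h1, h1]
    refine Finset.sum_congr rfl fun e' he' => ?_
    obtain ⟨he'1, he'2⟩ := Finset.mem_sdiff.1 he'
    have hdis : Disjoint e.toFinset e'.toFinset := by
      by_contra hn
      exact he'2 (Finset.mem_filter.2 ⟨he'1, hn⟩)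
    refine dependsOn_stdTerm e' j fun v hv => hkl v ?_
    simp only [Finset.coe_compl, Set.mem_compl_iff, Finset.mem_coe] at hv ⊢
    exact Finset.disjoint_right.1 hdis hv
  -- An exact identity, obtained by summing the vanishing expectations over `e` and expanding about
  -- `T k`. The defect splits into the fluctuation of ∑ ξ_e b_eᵀ around the identity and the Taylor
  -- remainders.
  have hstein : ∀ i, ∫ k, T k i * g i k ∂P - s * ∫ k, gg i i k ∂P =
      s * ∑ j, ∫ k, (∑ e ∈ G.edgeFinset, stdTerm G d π e i k * nbrTerm G d π e j k
        - if i = j then 1 else 0) * gg i j k ∂P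
      - ∑ e ∈ G.edgeFinset, ∫ k, stdTerm G d π e i k * R e i k ∂P := by
    intro i
    have h1 : ∑ e ∈ G.edgeFinset, ∫ k, stdTerm G d π e i k * R e i k ∂P =
        ∫ k, (∑ e ∈ G.edgeFinset, stdTerm G d π e i k *
          (-g i k + s * ∑ j, nbrTerm G d π e j k * gg i j k)) ∂P := by
      rw [integral_finsetSum _ fun _ _ => hfin _]
      refine Finset.sum_congr rfl fun e he => ?_
      have : ∀ k, stdTerm G d π e i k * R e i k = stdTerm G d π e i k *
          gaussSmooth (partialDeriv i h) s c (T k + -b e k) + stdTerm G d π e i k *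
          (-g i k + s * ∑ j, nbrTerm G d π e j k * gg i j k) := fun k => by
        simp only [hR, hb, Pi.neg_apply, neg_mul, Finset.sum_neg_distrib]
        ring
      simp only [this]
      rw [integral_add (hfin _) (hfin _), hzero e he i, zero_add]
    rw [h1, ← integral_finsetSum _ fun _ _ => hfin _, ← integral_const_mul, ← integral_const_mul,
      ← integral_sub (hfin _) (hfin _), ← integral_sub (hfin _) (hfin _)]
    congr 1
    funext k
    have h2 : ∑ e ∈ G.edgeFinset, stdTerm G d π e i k *
        (-g i k + s * ∑ j, nbrTerm G d π e j k * gg i j k) = -(T k i * g i k) +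
        s * ∑ j, (∑ e ∈ G.edgeFinset, stdTerm G d π e i k * nbrTerm G d π e j k) * gg i j k := by
      simp only [mul_add, Finset.sum_add_distrib, hT, Finset.sum_mul, Finset.mul_sum]
      congr 1
      · rw [← Finset.sum_neg_distrib]
        exact Finset.sum_congr rfl fun _ _ => by ring
      · rw [Finset.sum_comm]
        exact Finset.sum_congr rfl fun _ _ => Finset.sum_congr rfl fun _ _ => by ring
    rw [h2]
    simp only [sub_mul, Finset.sum_sub_distrib, ite_mul, one_mul, zero_mul, Finset.sum_ite_eq,
      Finset.mem_univ, if_true]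
    ring
  have hggb : ∀ i j k, |gg i j k| ≤ normD2 h := fun i j k =>
    abs_gaussSmooth_le (H.le_normD2 i j) s c (T k)
  have hterm1 : ∀ i j, |∫ k, (∑ e ∈ G.edgeFinset, stdTerm G d π e i k * nbrTerm G d π e j k
        - if i = j then 1 else 0) * gg i j k ∂P| ≤
      normD2 h * (32 * scale G π ^ 2 * √(numEdges G * (d : ℝ) ^ 3)) := fun i j => by
    calc _ ≤ ∫ k, normD2 h * |∑ e ∈ G.edgeFinset, stdTerm G d π e i k * nbrTerm G d π e j k
          - if i = j then 1 else 0| ∂P := by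
          refine (abs_integral_le_integral_abs).trans (integral_mono (hfin _) (hfin _) fun k => ?_)
          simp only [abs_mul]
          rw [mul_comm]
          exact mul_le_mul_of_nonneg_right (hggb i j k) (abs_nonneg _)
      _ ≤ _ := by
          rw [integral_const_mul]
          exact mul_le_mul_of_nonneg_left
            (integral_abs_sum_stdTerm_mul_nbrTerm_sub_le hc hG hN hd hπ hsum i j) normD2_nonneg
  have hterm2 : ∀ i, ∀ e ∈ G.edgeFinset, |∫ k, stdTerm G d π e i k * R e i k ∂P| ≤
      2 * scale G π * ((p * (4 * d * scale G π)) ^ 2 * normD3 h) := fun i e he => by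
    have := norm_integral_le_of_norm_le_const (μ := P) (f := fun k => stdTerm G d π e i k * R e i k)
      (C := 2 * scale G π * ((p * (4 * d * scale G π)) ^ 2 * normD3 h))
      (Eventually.of_forall fun k => by
        rw [norm_mul]
        exact mul_le_mul (abs_stdTerm_le hN hd hπ hsum i k) (hRb e he i k) (norm_nonneg _)
          (by positivity))
    simpa using this
  rw [integral_finsetSum _ fun _ _ => hfin _, integral_finsetSum _ fun _ _ => hfin _,
    Finset.mul_sum, ← Finset.sum_sub_distrib]
  have hi : ∀ i, |∫ k, T k i * g i k ∂P - s * ∫ k, gg i i k ∂P| ≤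
      p * (normD2 h * (32 * scale G π ^ 2 * √(numEdges G * (d : ℝ) ^ 3))) +
      numEdges G * (2 * scale G π * ((p * (4 * d * scale G π)) ^ 2 * normD3 h)) := fun i => by
    rw [hstein i]
    refine (abs_sub _ _).trans (add_le_add ?_ ?_)
    · rw [abs_mul]
      refine (mul_le_of_le_one_left (abs_nonneg _) hs).trans
        ((Finset.abs_sum_le_sum_abs _ _).trans ?_)
      have := Finset.sum_le_card_nsmul Finset.univ _ _ fun j _ => hterm1 i j
      simpa only [Finset.card_univ, Fintype.card_fin, nsmul_eq_mul] using this
    · refine (Finset.abs_sum_le_sum_abs _ _).trans ?_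
      have := Finset.sum_le_card_nsmul _ _ _ (hterm2 i)
      simpa only [nsmul_eq_mul, numEdges] using this
  calc _ ≤ ∑ i : Fin p, (p * (normD2 h * (32 * scale G π ^ 2 * √(numEdges G * (d : ℝ) ^ 3))) +
      numEdges G * (2 * scale G π * ((p * (4 * d * scale G π)) ^ 2 * normD3 h))) :=
        (Finset.abs_sum_le_sum_abs _ _).trans (Finset.sum_le_sum fun i _ => hi i)
    _ = _ := by
        rw [Finset.sum_const, Finset.card_univ, Fintype.card_fin, nsmul_eq_mul]
        ring

end Bound

/-! ### Constants, transfer to the original probability space, and the quantitative bound -/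

section NormalApproximation

variable {V : Type*} [Fintype V] [DecidableEq V] {p : ℕ} {G : SimpleGraph V} [DecidableRel G.Adj]
  {d : ℕ} {π : Fin p → ℝ}

omit [DecidableEq V] in
/-- The right-hand side of the normal approximation bound in terms of `scale G π`. -/
lemma scale_bound_le (hN : 0 < numEdges G) (hB : 1 ≤ constB π) (hp : 1 ≤ p) {D₂ D₃ : ℝ}
    (hD₂ : 0 ≤ D₂) (hD₃ : 0 ≤ D₃) :
    2 * (p ^ 2 * (D₂ * (32 * scale G π ^ 2 * √(numEdges G * (d : ℝ) ^ 3))) +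
      p * (numEdges G * (2 * scale G π * ((p * (4 * d * scale G π)) ^ 2 * D₃)))) ≤
    (numEdges G : ℝ) ^ (-(1 / 2) : ℝ) * 200 *
      ((p : ℝ) ^ 4 * constB π * D₂ * (d : ℝ) ^ (3 / 2 : ℝ)
        + (p : ℝ) ^ 6 * constB π ^ (3 / 2 : ℝ) * D₃ * (d : ℝ) ^ 2) := by
  have hN' : (0 : ℝ) < numEdges G := by exact_mod_cast hN
  have hp' : (1 : ℝ) ≤ p := by exact_mod_cast hp
  have hd0 : (0 : ℝ) ≤ d := Nat.cast_nonneg d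
  have hB0 : 0 ≤ constB π := by linarith
  have h32 : ∀ x : ℝ, 0 ≤ x → x ^ (3 / 2 : ℝ) = x * √x := fun x hx => by
    rw [Real.sqrt_eq_rpow, show (3 / 2 : ℝ) = 1 + 1 / 2 by norm_num,
      Real.rpow_add_of_nonneg hx zero_le_one (by norm_num), Real.rpow_one]
  have hN2 : (numEdges G : ℝ) ^ (-(1 / 2) : ℝ) = (√(numEdges G : ℝ))⁻¹ := by
    rw [Real.rpow_neg hN'.le, Real.sqrt_eq_rpow]
  rw [h32 _ hB0, h32 _ hd0, hN2]
  set N : ℝ := (numEdges G : ℝ)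
  have hx : 0 < √N := Real.sqrt_pos.2 hN'
  have hx2 : √N ^ 2 = N := Real.sq_sqrt hN'.le
  have hr : scale G π = √2 * √(constB π) / √N := by
    rw [scale, Real.sqrt_div' _ hN'.le, Real.sqrt_mul zero_le_two]
  have hr2 : scale G π ^ 2 = 2 * constB π / N := Real.sq_sqrt (by positivity)
  have hs : √(N * (d : ℝ) ^ 3) = √N * (d * √d) := by
    rw [Real.sqrt_mul hN'.le, show (d : ℝ) ^ 3 = d ^ 2 * d by ring, Real.sqrt_mul (sq_nonneg _),
      Real.sqrt_sq hd0]
  -- Gives 128√2 ≤ 192 ≤ 200, which fixes the universal constant.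
  have h2 : √2 ≤ 3 / 2 := Real.sqrt_le_iff.2 ⟨by norm_num, by norm_num⟩
  have hr2' : scale G π ^ 2 = 2 * constB π / √N ^ 2 := by rw [hx2, hr2]
  have e1 : p ^ 2 * (D₂ * (32 * scale G π ^ 2 * √(N * (d : ℝ) ^ 3))) =
      (√N)⁻¹ * (64 * (p ^ 2 * constB π * D₂ * (d * √d))) := by
    rw [hr2', hs]
    field_simp
    ring
  have e2 : p * (N * (2 * scale G π * ((p * (4 * d * scale G π)) ^ 2 * D₃))) =
      (√N)⁻¹ * (64 * √2 * (p ^ 3 * (constB π * √(constB π)) * D₃ * d ^ 2)) := by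
    have : p * (N * (2 * scale G π * ((p * (4 * d * scale G π)) ^ 2 * D₃))) =
      32 * p ^ 3 * d ^ 2 * D₃ * N * scale G π ^ 2 * scale G π := by ring
    rw [this, hr2, hr]
    field_simp
    ring
  rw [e1, e2]
  -- The argument yields p² and p³; as p ≥ 1 they are weakened to the stated powers.
  have i1 : (p : ℝ) ^ 2 ≤ p ^ 4 := pow_le_pow_right₀ hp' (by norm_num)
  have i2 : (p : ℝ) ^ 3 ≤ p ^ 6 := pow_le_pow_right₀ hp' (by norm_num)
  calc _ = (√N)⁻¹ * (128 * (p ^ 2 * constB π * D₂ * (d * √d)) +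
        128 * √2 * (p ^ 3 * (constB π * √(constB π)) * D₃ * d ^ 2)) := by ring
    _ ≤ (√N)⁻¹ * (200 * (p ^ 4 * constB π * D₂ * (d * √d)) +
        200 * (p ^ 6 * (constB π * √(constB π)) * D₃ * d ^ 2)) := by
      gcongr
      · norm_num
      · linarith
    _ = _ := by ring

/-- Randomness enters only through the coloring, so expectations can be computed on the finite space
`V → Fin p`, where every function is integrable. -/
lemma standardizedCount_eq_comp {Ω : Type*} (c : V → Ω → Fin p) (ω : Ω) :
    standardizedCount G d π c ω =
      standardizedCount G d π (fun v (k : V → Fin p) => k v) fun v => c v ω := by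
  funext i
  rw [standardizedCount_apply, standardizedCount_apply]

variable {Ω : Type*} [MeasurableSpace Ω] {μ : Measure Ω} [IsProbabilityMeasure μ]
  {c : V → Ω → Fin p}

omit [Fintype V] [DecidableEq V] [IsProbabilityMeasure μ] in
lemma IsIndepColoring.measurable_coloring (hc : IsIndepColoring μ π c) :
    Measurable fun ω v => c v ω := measurable_pi_lambda _ hc.measurable

omit [DecidableEq V] [IsProbabilityMeasure μ] in
lemma IsIndepColoring.integral_comp (hc : IsIndepColoring μ π c) (f : (V → Fin p) → ℝ) :
    ∫ ω, f (fun v => c v ω) ∂μ = ∫ k, f k ∂μ.map fun ω v => c v ω :=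
  (integral_map hc.measurable_coloring.aemeasurable
    (Measurable.of_discrete (f := f)).aestronglyMeasurable).symm

omit [IsProbabilityMeasure μ] in
lemma IsIndepColoring.measurable_standardizedCount (hc : IsIndepColoring μ π c) :
    Measurable (standardizedCount G d π c) := by
  rw [show standardizedCount G d π c = _ from funext (standardizedCount_eq_comp c)]
  exact (Measurable.of_discrete
    (f := standardizedCount G d π fun v (k : V → Fin p) => k v)).comp hc.measurable_coloring

lemma IsIndepColoring.integral_monoCount (hc : IsIndepColoring μ π c) (i : Fin p) :
    ∫ ω, (monoCount G c i ω : ℝ) ∂μ = meanVec G π i := by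
  have := Measure.isProbabilityMeasure_map (μ := μ) hc.measurable_coloring.aemeasurable
  simp only [monoCount_eq_sum]
  rw [hc.integral_comp fun k => ∑ e ∈ G.edgeFinset, allColor e.toFinset i k,
    integral_finsetSum _ fun _ _ => Integrable.of_finite, meanVec, numEdges, ← nsmul_eq_mul]
  refine Finset.sum_eq_card_nsmul fun e he => ?_
  rw [hc.map.integral_allColor, card_toFinset_of_mem_edgeFinset he]

lemma IsIndepColoring.covariance_monoCount (hc : IsIndepColoring μ π c)
    (hG : G.IsRegularOfDegree d) (i j : Fin p) :
    covariance (fun ω => (monoCount G c i ω : ℝ)) (fun ω => (monoCount G c j ω : ℝ)) μ =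
      covMatrix G d π i j := by
  have := Measure.isProbabilityMeasure_map (μ := μ) hc.measurable_coloring.aemeasurable
  rw [covariance, hc.integral_monoCount, hc.integral_monoCount]
  simp only [monoCount_sub_meanVec]
  rw [hc.integral_comp fun k => (∑ e ∈ G.edgeFinset, centeredMatch π e i k) *
    ∑ e ∈ G.edgeFinset, centeredMatch π e j k]
  exact integral_sum_mul_sum_centeredMatch hc.map hG i j

omit [DecidableEq V] in
lemma IsIndepColoring.sum_prob_eq_one [Nonempty V] (hc : IsIndepColoring μ π c) :
    ∑ i, π i = 1 := by
  have := Measure.isProbabilityMeasure_map (μ := μ) hc.measurable_coloring.aemeasurable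
  exact hc.map.sum_eq_one

omit [DecidableEq V] in
lemma IsIndepColoring.nonempty_color [Nonempty V] (hc : IsIndepColoring μ π c) :
    Nonempty (Fin p) := by
  by_contra hne
  rw [not_nonempty_iff] at hne
  simpa using hc.sum_prob_eq_one

lemma HasBoundedPartials.integrable_stdNormal {h : (Fin p → ℝ) → ℝ} (H : HasBoundedPartials h) :
    Integrable h (stdNormal p) := by
  simpa using integrable_of_partials_bounded H.exists_one H.bounded_one.choose_spec 0 1 0

lemma IsIndepColoring.integrable_comp_standardizedCount (hc : IsIndepColoring μ π c)
    (h : (Fin p → ℝ) → ℝ) : Integrable (fun ω => h (standardizedCount G d π c ω)) μ := by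
  have := Measure.isProbabilityMeasure_map (μ := μ) hc.measurable_coloring.aemeasurable
  simp only [standardizedCount_eq_comp c]
  exact (Integrable.of_finite (μ := μ.map fun ω v => c v ω)
    (f := fun k => h (standardizedCount G d π (fun v (k : V → Fin p) => k v) k))).comp_measurable
    hc.measurable_coloring

/-- Multivariate normal approximation for the standardized monochromatic edge counts. -/
theorem IsIndepColoring.abs_integral_sub_stdNormal_le [Nonempty V] (hc : IsIndepColoring μ π c)
    (hG : G.IsRegularOfDegree d) (hd : 1 ≤ d) (hπ : ∀ i, 0 < π i ∧ π i < 1)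
    {h : (Fin p → ℝ) → ℝ} (H : HasBoundedPartials h) :
    |∫ ω, h (standardizedCount G d π c ω) ∂μ - ∫ z, h z ∂stdNormal p| ≤
      (numEdges G : ℝ) ^ (-(1 / 2) : ℝ) * 200 *
        ((p : ℝ) ^ 4 * constB π * normD2 h * (d : ℝ) ^ (3 / 2 : ℝ)
          + (p : ℝ) ^ 6 * constB π ^ (3 / 2 : ℝ) * normD3 h * (d : ℝ) ^ 2) := by
  have := Measure.isProbabilityMeasure_map (μ := μ) hc.measurable_coloring.aemeasurable
  have hN := numEdges_pos hG hd
  have := hc.nonempty_color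
  have hp : 1 ≤ p := Fin.pos_iff_nonempty.2 this
  simp only [standardizedCount_eq_comp c]
  rw [hc.integral_comp fun k => h (standardizedCount G d π (fun v (k : V → Fin p) => k v) k)]
  have hdef := fun s c hs => abs_stein_defect_le (s := s) H hc.map hG hN hd hπ hc.sum_prob_eq_one
    (standardizedCount G d π fun v (k : V → Fin p) => k v)
    (fun k i => standardizedCount_apply _ k i) hs c
  have hle := H.abs_integral_sub_le _ hdef
  exact hle.trans (scale_bound_le hN (constB_spec hπ).1 hp normD2_nonneg normD3_nonneg)

end NormalApproximation

/-! ### Cosine test functions and convergence in distribution -/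

section Convergence

variable {p : ℕ}

/-- The function `x ↦ a cos(⟨t, x⟩ + φ)`. -/
noncomputable def cosWave (t : Fin p → ℝ) (a φ : ℝ) (x : Fin p → ℝ) : ℝ :=
  a * Real.cos (∑ i, x i * t i + φ)

lemma abs_cosWave_le (t : Fin p → ℝ) (a φ : ℝ) (x : Fin p → ℝ) : |cosWave t a φ x| ≤ |a| := by
  rw [cosWave, abs_mul]
  exact mul_le_of_le_one_right (abs_nonneg a) (Real.abs_cos_le_one _)

/-- As −sin x = cos(x + π/2), the family is closed under partial derivatives, which makes all orders
explicit at once. -/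
lemma hasLineDerivAt_cosWave (t : Fin p → ℝ) (a φ : ℝ) (x : Fin p → ℝ) (i : Fin p) :
    HasLineDerivAt ℝ (cosWave t a φ) (cosWave t (a * t i) (φ + Real.pi / 2) x) x
      (Pi.single i 1) := by
  have h1 : HasDerivAt (fun s : ℝ => (∑ j, x j * t j + φ) + s * t i) (t i) 0 := by
    simpa using ((hasDerivAt_id (0 : ℝ)).mul_const (t i)).const_add (∑ j, x j * t j + φ)
  have h2 := h1.cos.const_mul a
  have e : (fun s : ℝ => cosWave t a φ (x + s • Pi.single i 1)) =
      fun s : ℝ => a * Real.cos ((∑ j, x j * t j + φ) + s * t i) := by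
    funext s
    simp only [cosWave, Pi.add_apply, Pi.smul_apply, Pi.single_apply, smul_eq_mul, mul_ite, mul_one,
      mul_zero, add_mul, ite_mul, zero_mul, Finset.sum_add_distrib, Finset.sum_ite_eq',
      Finset.mem_univ, if_true]
    ring_nf
  rw [HasLineDerivAt, e]
  refine h2.congr_deriv ?_
  rw [cosWave, ← add_assoc, Real.cos_add_pi_div_two]
  simp only [zero_mul, add_zero]
  ring

lemma partialDeriv_cosWave (t : Fin p → ℝ) (a φ : ℝ) (i : Fin p) :
    partialDeriv i (cosWave t a φ) = cosWave t (a * t i) (φ + Real.pi / 2) :=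
  funext fun x => (hasLineDerivAt_cosWave t a φ x i).lineDeriv

lemma hasPartials_cosWave (t : Fin p → ℝ) (a φ : ℝ) : HasPartials (cosWave t a φ) :=
  fun i x => (hasLineDerivAt_cosWave t a φ x i).lineDifferentiableAt

lemma hasBoundedPartials_cosWave (t : Fin p → ℝ) (a φ : ℝ) :
    HasBoundedPartials (cosWave t a φ) := by
  have ht : ∀ i, |t i| ≤ ‖t‖ := fun i => norm_le_pi_norm t i
  refine ⟨hasPartials_cosWave t a φ, fun i => ?_, fun i j => ?_, ⟨|a| * ‖t‖, ?_⟩,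
    ⟨|a| * ‖t‖ * ‖t‖, ?_⟩, ⟨|a| * ‖t‖ * ‖t‖ * ‖t‖, ?_⟩⟩
  · rw [partialDeriv_cosWave]
    exact hasPartials_cosWave _ _ _
  · rw [partialDeriv_cosWave, partialDeriv_cosWave]
    exact hasPartials_cosWave _ _ _
  · intro i x
    rw [partialDeriv_cosWave]
    refine (abs_cosWave_le _ _ _ _).trans ?_
    rw [abs_mul]
    gcongr
    exact ht i
  · intro i j x
    rw [partialDeriv_cosWave, partialDeriv_cosWave]
    refine (abs_cosWave_le _ _ _ _).trans ?_
    rw [abs_mul, abs_mul]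
    gcongr
    exacts [ht i, ht j]
  · intro i j k x
    rw [partialDeriv_cosWave, partialDeriv_cosWave, partialDeriv_cosWave]
    refine (abs_cosWave_le _ _ _ _).trans ?_
    rw [abs_mul, abs_mul, abs_mul]
    gcongr
    exacts [ht i, ht j, ht k]

/-- The phase −π/2 turns cosine into sine, so phases 0 and −π/2 give the real and imaginary parts.
-/
lemma charFun_map_toLp {Ω : Type*} [MeasurableSpace Ω] {μ : Measure Ω} [IsProbabilityMeasure μ]
    {X : Ω → Fin p → ℝ} (hX : Measurable X) (t : EuclideanSpace ℝ (Fin p)) :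
    charFun (μ.map fun ω => WithLp.toLp 2 (X ω)) t =
      ((∫ ω, cosWave (WithLp.ofLp t) 1 0 (X ω) ∂μ : ℝ) : ℂ) +
        ((∫ ω, cosWave (WithLp.ofLp t) 1 (-(Real.pi / 2)) (X ω) ∂μ : ℝ) : ℂ) * Complex.I := by
  have hint : ∀ φ, Integrable (fun ω => cosWave (WithLp.ofLp t) 1 φ (X ω)) μ := fun φ =>
    Integrable.of_bound (by unfold cosWave; fun_prop) |(1 : ℝ)| (Eventually.of_forall fun ω =>
      abs_cosWave_le _ _ _ _)
  rw [charFun_apply, integral_map (by fun_prop) (by fun_prop), ← integral_complex_ofReal,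
    ← integral_complex_ofReal, ← integral_mul_const, ← integral_add (hint 0).ofReal
      ((hint _).ofReal.mul_const _)]
  congr 1
  funext ω
  have : inner ℝ (WithLp.toLp 2 (X ω)) t = ∑ i, X ω i * WithLp.ofLp t i := by
    simp [PiLp.inner_apply, mul_comm]
  rw [this, Complex.exp_mul_I, cosWave, cosWave, ← sub_eq_add_neg, Real.cos_sub_pi_div_two]
  simp

/-- Convergence of expectations of smooth functions implies convergence in distribution. -/
theorem tendstoInDistribution_of_hasBoundedPartials {Ω : ℕ → Type*} [∀ n, MeasurableSpace (Ω n)]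
    {μ : ∀ n, Measure (Ω n)} [∀ n, IsProbabilityMeasure (μ n)] {X : ∀ n, Ω n → Fin p → ℝ}
    (hX : ∀ n, Measurable (X n)) {ν : Measure (Fin p → ℝ)} [IsProbabilityMeasure ν]
    (hlim : ∀ h, HasBoundedPartials h →
      Tendsto (fun n => ∫ ω, h (X n ω) ∂μ n) atTop (𝓝 (∫ z, h z ∂ν))) :
    TendstoInDistribution X atTop (fun z : Fin p → ℝ => z) μ ν := by
  -- Characteristic functions need an inner product, so Lévy's continuity theorem is applied in
  -- `EuclideanSpace` and the limit is carried back by the continuous map `WithLp.ofLp`.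
  have hmeas : Measurable (WithLp.toLp 2 : (Fin p → ℝ) → EuclideanSpace ℝ (Fin p)) := by fun_prop
  have key : TendstoInDistribution (fun n ω => WithLp.toLp 2 (X n ω)) atTop
      (fun z : Fin p → ℝ => (WithLp.toLp 2 z : EuclideanSpace ℝ (Fin p))) μ ν := by
    refine ⟨fun n => (hmeas.comp (hX n)).aemeasurable, hmeas.aemeasurable, ?_⟩
    refine ProbabilityMeasure.tendsto_of_tendsto_charFun fun t => ?_
    simp only [ProbabilityMeasure.coe_mk]
    rw [charFun_map_toLp measurable_id' t]
    simp only [charFun_map_toLp (hX _) t]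
    have h1 := hlim _ (hasBoundedPartials_cosWave (WithLp.ofLp t) 1 0)
    have h2 := hlim _ (hasBoundedPartials_cosWave (WithLp.ofLp t) 1 (-(Real.pi / 2)))
    exact ((Complex.continuous_ofReal.tendsto _).comp h1).add
      (((Complex.continuous_ofReal.tendsto _).comp h2).mul_const _)
  exact key.continuous_comp (g := WithLp.ofLp) (by fun_prop)

end Convergence

end ColorMatching

/-! ### The main theorem -/

theorem theorem4p3 :
    (∃ M : ℝ, ∀ (V : Type u) [Fintype V] [DecidableEq V] [Nonempty V]
      (G : SimpleGraph V) [DecidableRel G.Adj] (d p : ℕ) (π : Fin p → ℝ)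
      (Ω : Type v) [MeasurableSpace Ω] (μ : Measure Ω) [IsProbabilityMeasure μ]
      (c : V → Ω → Fin p),
      G.IsRegularOfDegree d → 1 ≤ d → (∀ i, 0 < π i ∧ π i < 1) →
      ColorMatching.IsIndepColoring μ π c →
        (∀ i, ∫ ω, (ColorMatching.monoCount G c i ω : ℝ) ∂μ = ColorMatching.meanVec G π i) ∧
        (∀ i j, covariance (fun ω => (ColorMatching.monoCount G c i ω : ℝ))
            (fun ω => (ColorMatching.monoCount G c j ω : ℝ)) μ =
          ColorMatching.covMatrix G d π i j) ∧
        (ColorMatching.covMatrix G d π).PosDef ∧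
        ∀ h : (Fin p → ℝ) → ℝ, ColorMatching.HasBoundedPartials h →
          Integrable (fun ω => h (ColorMatching.standardizedCount G d π c ω)) μ ∧
          Integrable h (ColorMatching.stdNormal p) ∧
          |∫ ω, h (ColorMatching.standardizedCount G d π c ω) ∂μ
              - ∫ z, h z ∂(ColorMatching.stdNormal p)| ≤
            (ColorMatching.numEdges G : ℝ) ^ (-(1 / 2) : ℝ) * M *
              ((p : ℝ) ^ 4 * ColorMatching.constB π * ColorMatching.normD2 h
                  * (d : ℝ) ^ (3 / 2 : ℝ)
                + (p : ℝ) ^ 6 * ColorMatching.constB π ^ (3 / 2 : ℝ) * ColorMatching.normD3 h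
                  * (d : ℝ) ^ 2)) ∧
    (∀ (p : ℕ) (V : ℕ → Type u) [∀ n, Fintype (V n)] [∀ n, DecidableEq (V n)]
      [∀ n, Nonempty (V n)] (G : ∀ n, SimpleGraph (V n)) [∀ n, DecidableRel (G n).Adj]
      (d : ℕ → ℕ) (π : ℕ → Fin p → ℝ)
      (Ω : ℕ → Type v) [∀ n, MeasurableSpace (Ω n)] (μ : ∀ n, Measure (Ω n))
      [∀ n, IsProbabilityMeasure (μ n)] (c : ∀ n, V n → Ω n → Fin p),
      (∀ n, (G n).IsRegularOfDegree (d n)) → (∀ n, 1 ≤ d n) →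
      (∀ n i, 0 < π n i ∧ π n i < 1) →
      (∀ n, ColorMatching.IsIndepColoring (μ n) (π n) (c n)) →
      Tendsto (fun n => (ColorMatching.numEdges (G n) : ℝ) ^ (-(1 / 2) : ℝ)
        * (ColorMatching.constB (π n) ^ (3 / 2 : ℝ) * (d n : ℝ) ^ 2)) atTop (𝓝 0) →
      TendstoInDistribution
        (fun n => ColorMatching.standardizedCount (G n) (d n) (π n) (c n)) atTop
        (fun z : Fin p → ℝ => z) μ (ColorMatching.stdNormal p)) := by
  refine ⟨⟨200, fun V _ _ _ G _ d p π Ω _ μ _ c hG hd hπ hc =>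
    ⟨hc.integral_monoCount, hc.covariance_monoCount hG,
      ColorMatching.covMatrix_posDef (ColorMatching.numEdges_pos hG hd) hd hπ hc.sum_prob_eq_one,
      fun h H => ⟨hc.integrable_comp_standardizedCount h, H.integrable_stdNormal,
        hc.abs_integral_sub_stdNormal_le hG hd hπ H⟩⟩⟩, ?_⟩
  intro p V _ _ _ G _ d π Ω _ μ _ c hG hd hπ hc hlim
  refine ColorMatching.tendstoInDistribution_of_hasBoundedPartials
    (fun n => (hc n).measurable_standardizedCount) fun h H => ?_
  rw [tendsto_iff_dist_tendsto_zero]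
  -- With `p` and `h` fixed, both error terms are dominated by the assumed null sequence: B ≥ 1 and
  -- d ≥ 1 allow B ≤ B^{3/2} and d^{3/2} ≤ d².
  have hlim' := hlim.mul_const
    (200 * ((p : ℝ) ^ 4 * ColorMatching.normD2 h + (p : ℝ) ^ 6 * ColorMatching.normD3 h))
  rw [zero_mul] at hlim'
  refine squeeze_zero (fun _ => dist_nonneg) (fun n => ?_) hlim'
  rw [Real.dist_eq]
  refine ((hc n).abs_integral_sub_stdNormal_le (hG n) (hd n) (hπ n) H).trans ?_
  have := (hc n).nonempty_color
  have hB := (ColorMatching.constB_spec (hπ n)).1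
  have hd' : (1 : ℝ) ≤ d n := by exact_mod_cast hd n
  have hD2 := ColorMatching.normD2_nonneg (h := h)
  have hB' : ColorMatching.constB (π n) ≤ ColorMatching.constB (π n) ^ (3 / 2 : ℝ) :=
    Real.self_le_rpow_of_one_le hB (by norm_num)
  have hdd : (d n : ℝ) ^ (3 / 2 : ℝ) ≤ (d n : ℝ) ^ 2 := by
    rw [← Real.rpow_natCast]
    exact Real.rpow_le_rpow_of_exponent_le hd' (by norm_num)
  have hB0 : 0 ≤ ColorMatching.constB (π n) := zero_le_one.trans hB
  calc _ ≤ (ColorMatching.numEdges (G n) : ℝ) ^ (-(1 / 2) : ℝ) * 200 *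
        ((p : ℝ) ^ 4 * ColorMatching.constB (π n) ^ (3 / 2 : ℝ) * ColorMatching.normD2 h
            * (d n : ℝ) ^ 2
          + (p : ℝ) ^ 6 * ColorMatching.constB (π n) ^ (3 / 2 : ℝ) * ColorMatching.normD3 h
            * (d n : ℝ) ^ 2) := by gcongr
    _ = _ := by ring
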